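/- Let $K$ be a field of characteristic $0$ (for instance $K=\mathbb C$), let $M,N\ge 0$, and let $z=(z_1,\dots,z_N)\in K^N$ and $\lambda=(\lambda_1,\dots,\lambda_M)\in K^M$ each have pairwise distinct entries. In $U(\mathfrak{gl}_M)^{\otimes N}$ write $E_{ij}^{(a)}$ for the matrix unit $E_{ij}$ in the $a$-th factor, and consider the row determinant $$\mathcal D(M,N,z,\lambda,u)=\operatorname{rdet}\Big((\partial_u-\lambda_i)\delta_{ij}-\sum_{a=1}^N\frac{E^{(a)}_{ji}}{u-z_a}\Big)_{i,j=1}^M=\partial_u^M+G_1(u)\partial_u^{M-1}+\dots+G_M(u),$$ where $\operatorname{rdet}(c_{ij})=\sum_{\sigma\in S_M}\operatorname{sgn}(\sigma)\,c_{1\sigma_1}\cdots c_{M\sigma_M}$. The $G_i(u)$ are rational functions of $u$ with values in $U(\mathfrak{gl}_M)^{\otimes N}$, and the Bethe subalgebra $\mathcal G(M,N,z,\lambda)\subset U(\mathfrak{gl}_M)^{\otimes N}$ is generated by the coefficients of the polynomials $G_i(u)\prod_a(u-z_a)^i$, $1\le i\le M$. Let $\mathfrak{gl}_M$ act on $K[x_1,\dots,x_M]$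 by $E_{ij}\mapsto x_i\,\partial/\partial x_j$, and let $L^{(M)}_d$ be the submodule of homogeneous polynomials of degree $d$. Let $n\in\mathbb Z_{\ge0}^N$, $m\in\mathbb Z_{\ge0}^M$ with $\sum_a n_a=\sum_b m_b$; let $L_n[m]$ be the subspace of weight $m$ in the $\mathfrak{gl}_M$-module $\bigotimes_{a=1}^N L^{(M)}_{n_a}$, and $L_m[n]$ the subspace of weight $n$ in the $\mathfrak{gl}_N$-module $\bigotimes_{b=1}^M L^{(N)}_{m_b}$. The isomorphisms of $K[x_1,\dots,x_M]^{\otimes N}$ and of $K[x_1,\dots,x_N]^{\otimes M}$ with $K[x_{ij}]_{1\le i\le M,\,1\le j\le N}$, which send $x_i$ in the $j$-th factor, respectively $x_j$ in the $i$-th factor, to $x_{ij}$, identify $L_n[m]$ with $L_m[n]$. Let $w\in L_n[m]$ be a common eigenvector of $\mathcal G(M,N,z,\lambda)$ (so $w\ne0$), and regard it also as a vector of $L_m[n]$ under this identification. Then $w$ is a common eigenvector of $\mathcal G(N,M,\lambda,z)$, so that $\mathcal D(M,N,z,\lambda,u)$ and $\mathcal D(N,M,\lambda,z,v)$ act on $w$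 as monic scalar differential operators with rational coefficients $$D_w(M,N,z,\lambda,u)=\partial_u^M+G_1^w(u)\,\partial_u^{M-1}+\dots+G_M^w(u)$$ and $D_w(N,M,\lambda,z,v)$, of orders $M$ and $N$, whose coefficients are the eigenvalues on $w$ of the coefficients of the row determinants. Moreover there are numbers $A_{ab,w}\in K$, $0\le a\le N$, $0\le b\le M$, such that $$\prod_{a=1}^N(u-z_a)\,D_w(M,N,z,\lambda,u)=\sum_{a=0}^N\sum_{b=0}^M A_{ab,w}\,u^a\partial_u^b,\qquad \prod_{b=1}^M(v-\lambda_b)\,D_w(N,M,\lambda,z,v)=\sum_{a=0}^N\sum_{b=0}^M A_{ab,w}\,v^b\partial_v^a,$$ with the same numbers $A_{ab,w}$ in both formulas. -/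

import Mathlib

open scoped TensorProduct

noncomputable section

namespace BetheDuality

attribute [local instance] LieRing.ofAssociativeRing

/-! ### The derivative of a rational function -/

section RatDeriv

variable (K : Type*) [Field K]

/-- The formula `(p' q - p q') / q ^ 2` for a pair of polynomials. -/
def quotientRule (p q : Polynomial K) : RatFunc K :=
  (algebraMap (Polynomial K) (RatFunc K) (Polynomial.derivative p) * algebraMap _ _ q -
    algebraMap _ _ p * algebraMap _ _ (Polynomial.derivative q)) / algebraMap _ _ q ^ 2

variable {K} in
theorem quotientRule_eq {p q r s : Polynomial K} (hq : q ≠ 0) (hs : s ≠ 0)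
    (h : algebraMap (Polynomial K) (RatFunc K) p / algebraMap _ _ q
      = algebraMap _ _ r / algebraMap _ _ s) : quotientRule K p q = quotientRule K r s := by
  have hq' : algebraMap (Polynomial K) (RatFunc K) q ≠ 0 := RatFunc.algebraMap_ne_zero hq
  have hs' : algebraMap (Polynomial K) (RatFunc K) s ≠ 0 := RatFunc.algebraMap_ne_zero hs
  have h1 : algebraMap (Polynomial K) (RatFunc K) p * algebraMap _ _ s
      = algebraMap _ _ r * algebraMap _ _ q := by
    rwa [div_eq_div_iff hq' hs'] at h
  have h2 : p * s = r * q := by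
    apply RatFunc.algebraMap_injective K
    simpa using h1
  have h3 := congrArg (algebraMap (Polynomial K) (RatFunc K))
    (congrArg Polynomial.derivative h2)
  simp only [Polynomial.derivative_mul, map_add, map_mul] at h3
  unfold quotientRule
  rw [div_eq_div_iff (pow_ne_zero 2 hq') (pow_ne_zero 2 hs')]
  linear_combination (algebraMap (Polynomial K) (RatFunc K) q * algebraMap _ _ s) * h3
    - (algebraMap (Polynomial K) (RatFunc K) q
        * algebraMap (Polynomial K) (RatFunc K) (Polynomial.derivative s)
      + algebraMap (Polynomial K) (RatFunc K) (Polynomial.derivative q)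
        * algebraMap (Polynomial K) (RatFunc K) s) * h1

variable {K} in
theorem quotientRule_num_denom {p q : Polynomial K} (hq : q ≠ 0) {f : RatFunc K}
    (h : f = algebraMap (Polynomial K) (RatFunc K) p / algebraMap _ _ q) :
    quotientRule K f.num f.denom = quotientRule K p q :=
  quotientRule_eq f.denom_ne_zero hq (by rw [RatFunc.num_div_denom, h])

/-- The derivative `d/du` on the field `K(u)` of rational functions. -/
def ratDeriv : Derivation K (RatFunc K) (RatFunc K) :=
  Derivation.mk'
    { toFun := fun f => quotientRule K f.num f.denom
      map_add' := fun f g => by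
        have hf : algebraMap (Polynomial K) (RatFunc K) f.denom ≠ 0 :=
          RatFunc.algebraMap_ne_zero f.denom_ne_zero
        have hg : algebraMap (Polynomial K) (RatFunc K) g.denom ≠ 0 :=
          RatFunc.algebraMap_ne_zero g.denom_ne_zero
        rw [quotientRule_num_denom (p := f.num * g.denom + f.denom * g.num)
          (q := f.denom * g.denom) (mul_ne_zero f.denom_ne_zero g.denom_ne_zero)]
        · simp only [quotientRule, Polynomial.derivative_mul, map_add, map_mul]
          field_simp
          ring
        · conv_lhs => rw [← RatFunc.num_div_denom f, ← RatFunc.num_div_denom g]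
          simp only [map_add, map_mul]
          field_simp
      map_smul' := fun c f => by
        rw [quotientRule_num_denom (p := Polynomial.C c * f.num) (q := f.denom) f.denom_ne_zero]
        · simp only [quotientRule, Polynomial.derivative_mul, Polynomial.derivative_C, zero_mul,
            zero_add, map_mul, RatFunc.algebraMap_C, RingHom.id_apply, RatFunc.smul_eq_C_mul]
          ring
        · conv_lhs => rw [← RatFunc.num_div_denom f]
          rw [RatFunc.smul_eq_C_mul, map_mul, RatFunc.algebraMap_C, mul_div_assoc] }
    (fun f g => by
      have hf : algebraMap (Polynomial K) (RatFunc K) f.denom ≠ 0 :=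
        RatFunc.algebraMap_ne_zero f.denom_ne_zero
      have hg : algebraMap (Polynomial K) (RatFunc K) g.denom ≠ 0 :=
        RatFunc.algebraMap_ne_zero g.denom_ne_zero
      change quotientRule K (f * g).num (f * g).denom =
        f • quotientRule K g.num g.denom + g • quotientRule K f.num f.denom
      rw [quotientRule_num_denom (p := f.num * g.num)
          (q := f.denom * g.denom) (mul_ne_zero f.denom_ne_zero g.denom_ne_zero)]
      · conv_rhs => 
          rw [smul_eq_mul, smul_eq_mul]
          enter [1, 1]
          rw [← RatFunc.num_div_denom f]
        conv_rhs => 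
          enter [2, 1]
          rw [← RatFunc.num_div_denom g]
        simp only [quotientRule, Polynomial.derivative_mul, map_add, map_mul]
        field_simp
        ring
      · conv_lhs => rw [← RatFunc.num_div_denom f, ← RatFunc.num_div_denom g]
        simp only [map_mul]
        field_simp)

theorem ratDeriv_algebraMap (p : Polynomial K) :
    ratDeriv K (algebraMap (Polynomial K) (RatFunc K) p)
      = algebraMap _ _ (Polynomial.derivative p) := by
  change quotientRule K _ _ = _
  rw [quotientRule_num_denom (p := p) (q := 1) one_ne_zero (by simp)]
  simp [quotientRule]

end RatDeriv

/-! ### Rings of differential operators -/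

section DiffRing

/-- A derivation of a (not necessarily commutative) ring. -/
structure RingDeriv (B : Type*) [Ring B] extends B →+ B where
  leibniz' : ∀ a b, toFun (a * b) = toFun a * b + a * toFun b

variable {B : Type*} [Ring B]

namespace RingDeriv

theorem leibniz (δ : RingDeriv B) (a b : B) :
    δ.toAddMonoidHom (a * b) = δ.toAddMonoidHom a * b + a * δ.toAddMonoidHom b :=
  δ.leibniz' a b

theorem map_one (δ : RingDeriv B) : δ.toAddMonoidHom 1 = 0 := by
  have h := δ.leibniz 1 1
  simpa using h

end RingDeriv

/-- The ring of differential operators `∑ k, b k * ∂ ^ k` with coefficients `b k` in `B`, where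
`∂ * b = b * ∂ + δ b`. An operator is given by the finitely supported family of its
coefficients. -/
def DiffRing (_δ : RingDeriv B) : Type _ := ℕ →₀ B

namespace DiffRing

variable (δ : RingDeriv B)

instance : AddCommGroup (DiffRing δ) := inferInstanceAs (AddCommGroup (ℕ →₀ B))

/-- The operator `b * ∂ ^ k`. -/
def monomial (k : ℕ) : B →+ DiffRing δ := Finsupp.singleAddHom k

variable {δ} in
/-- The coefficient of `∂ ^ k`. -/
def coeff (D : DiffRing δ) (k : ℕ) : B := (show ℕ →₀ B from D) k

theorem hom_ext {G : Type*} [AddCommGroup G] {f g : DiffRing δ →+ G}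
    (h : ∀ k b, f (monomial δ k b) = g (monomial δ k b)) : f = g :=
  Finsupp.addHom_ext h

theorem end_ext {f g : AddMonoid.End (DiffRing δ)}
    (h : ∀ k b, f (monomial δ k b) = g (monomial δ k b)) : f = g :=
  hom_ext δ h

theorem end_mul (f g : AddMonoid.End (DiffRing δ)) (D : DiffRing δ) : (f * g) D = f (g D) := rfl

theorem end_add (f g : AddMonoid.End (DiffRing δ)) (D : DiffRing δ) :
    (f + g) D = f D + g D := rfl

/-- Left multiplication by `∂`: `∂ * (b * ∂ ^ k) = δ b * ∂ ^ k + b * ∂ ^ (k + 1)`. -/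
def leftDel : AddMonoid.End (DiffRing δ) :=
  Finsupp.liftAddHom (M := B) (N := DiffRing δ) fun k =>
    (monomial δ k).comp δ.toAddMonoidHom + monomial δ (k + 1)

/-- Left multiplication by a fixed `b`, as an additive map. -/
def leftCoeffAux (b : B) : AddMonoid.End (DiffRing δ) :=
  Finsupp.liftAddHom (M := B) (N := DiffRing δ) fun k =>
    (monomial δ k).comp (AddMonoidHom.mulLeft b)

theorem leftCoeffAux_monomial (a : B) (k : ℕ) (b : B) :
    leftCoeffAux δ a (monomial δ k b) = monomial δ k (a * b) :=
  Finsupp.liftAddHom_apply_single (M := B) (N := DiffRing δ) _ k b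

/-- Left multiplication by `b`: `b * (c * ∂ ^ k) = (b * c) * ∂ ^ k`. -/
def leftCoeff : B →+ AddMonoid.End (DiffRing δ) where
  toFun := leftCoeffAux δ
  map_zero' := end_ext δ fun k c => by
    rw [leftCoeffAux_monomial, zero_mul, map_zero]
    rfl
  map_add' a b := end_ext δ fun k c => by
    rw [end_add, leftCoeffAux_monomial, leftCoeffAux_monomial, leftCoeffAux_monomial, add_mul,
      map_add]

theorem leftDel_monomial (k : ℕ) (b : B) :
    leftDel δ (monomial δ k b) = monomial δ k (δ.toAddMonoidHom b) + monomial δ (k + 1) b :=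
  Finsupp.liftAddHom_apply_single (M := B) (N := DiffRing δ) _ k b

theorem leftCoeff_monomial (a : B) (k : ℕ) (b : B) :
    leftCoeff δ a (monomial δ k b) = monomial δ k (a * b) :=
  leftCoeffAux_monomial δ a k b

/-- Left multiplication by `∑ k, b k * ∂ ^ k`. -/
def leftMul : DiffRing δ →+ AddMonoid.End (DiffRing δ) :=
  Finsupp.liftAddHom (M := B) (N := AddMonoid.End (DiffRing δ)) fun k =>
    (AddMonoidHom.mulRight (leftDel δ ^ k)).comp (leftCoeff δ)

theorem leftMul_monomial (k : ℕ) (b : B) :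
    leftMul δ (monomial δ k b) = leftCoeff δ b * leftDel δ ^ k :=
  Finsupp.liftAddHom_apply_single (M := B) (N := AddMonoid.End (DiffRing δ)) _ k b

theorem leftCoeff_mul (a b : B) : leftCoeff δ (a * b) = leftCoeff δ a * leftCoeff δ b :=
  end_ext δ fun k c => by
    rw [end_mul]
    simp only [leftCoeff_monomial, mul_assoc]

theorem leftDel_mul_leftCoeff (b : B) :
    leftDel δ * leftCoeff δ b = leftCoeff δ (δ.toAddMonoidHom b) + leftCoeff δ b * leftDel δ :=
  end_ext δ fun k c => by
    rw [end_add, end_mul, end_mul]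
    simp only [leftCoeff_monomial, leftDel_monomial, map_add, δ.leibniz, add_assoc]

theorem leftMul_leftCoeff (a : B) (c : DiffRing δ) :
    leftMul δ (leftCoeff δ a c) = leftCoeff δ a * leftMul δ c := by
  have h : (leftMul δ).comp (leftCoeff δ a)
      = (AddMonoidHom.mulLeft (leftCoeff δ a)).comp (leftMul δ) :=
    hom_ext δ fun k b => by
      change leftMul δ (leftCoeff δ a (monomial δ k b))
        = leftCoeff δ a * leftMul δ (monomial δ k b)
      rw [leftCoeff_monomial, leftMul_monomial, leftMul_monomial, leftCoeff_mul, mul_assoc]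
  exact DFunLike.congr_fun h c

theorem leftMul_leftDel (c : DiffRing δ) :
    leftMul δ (leftDel δ c) = leftDel δ * leftMul δ c := by
  have h : (leftMul δ).comp (leftDel δ)
      = (AddMonoidHom.mulLeft (leftDel δ)).comp (leftMul δ) :=
    hom_ext δ fun k b => by
      change leftMul δ (leftDel δ (monomial δ k b)) = leftDel δ * leftMul δ (monomial δ k b)
      rw [leftDel_monomial, map_add, leftMul_monomial, leftMul_monomial, leftMul_monomial, pow_succ', ← mul_assoc,
        ← mul_assoc, leftDel_mul_leftCoeff, add_mul]
  exact DFunLike.congr_fun h c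

theorem leftMul_leftMul (b c : DiffRing δ) :
    leftMul δ (leftMul δ b c) = leftMul δ b * leftMul δ c := by
  have hpow : ∀ (k : ℕ) (c : DiffRing δ),
      leftMul δ ((leftDel δ ^ k) c) = leftDel δ ^ k * leftMul δ c := by
    intro k
    induction k with
    | zero => intro c; simp
    | succ k ih =>
      intro c
      rw [pow_succ', end_mul, leftMul_leftDel, ih, mul_assoc]
  have h : (leftMul δ).comp ((leftMul δ).flip c)
      = (AddMonoidHom.mulRight (leftMul δ c)).comp (leftMul δ) :=
    hom_ext δ fun k b => by
      change leftMul δ (leftMul δ (monomial δ k b) c) = leftMul δ (monomial δ k b) * leftMul δ c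
      rw [leftMul_monomial, end_mul, leftMul_leftCoeff, hpow, mul_assoc]
  exact DFunLike.congr_fun h b

theorem leftDel_pow_one (k : ℕ) : (leftDel δ ^ k) (monomial δ 0 1) = monomial δ k 1 := by
  induction k with
  | zero => rfl
  | succ k ih =>
    rw [pow_succ', end_mul, ih, leftDel_monomial, δ.map_one, map_zero, zero_add]

theorem leftMul_one : leftMul δ (monomial δ 0 1) = 1 := by
  rw [leftMul_monomial, pow_zero, mul_one]
  exact end_ext δ fun k b => by rw [leftCoeff_monomial, one_mul]; rfl

theorem leftMul_apply_one (b : DiffRing δ) : leftMul δ b (monomial δ 0 1) = b := by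
  have h : (leftMul δ).flip (monomial δ 0 1) = AddMonoidHom.id _ :=
    hom_ext δ fun k b => by
      change leftMul δ (monomial δ k b) (monomial δ 0 1) = monomial δ k b
      rw [leftMul_monomial, end_mul, leftDel_pow_one, leftCoeff_monomial, mul_one]
  exact DFunLike.congr_fun h b

instance : Ring (DiffRing δ) where
  __ := (inferInstance : AddCommGroup (DiffRing δ))
  mul b c := leftMul δ b c
  one := monomial δ 0 1
  left_distrib a b c := map_add (leftMul δ a) b c
  right_distrib a b c := DFunLike.congr_fun (map_add (leftMul δ) a b) c
  zero_mul a := DFunLike.congr_fun (map_zero (leftMul δ)) a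
  mul_zero a := map_zero (leftMul δ a)
  mul_assoc a b c := DFunLike.congr_fun (leftMul_leftMul δ a b) c
  one_mul a := DFunLike.congr_fun (leftMul_one δ) a
  mul_one a := leftMul_apply_one δ a

theorem monomial_mul (k : ℕ) (b : B) (D : DiffRing δ) :
    monomial δ k b * D = leftCoeff δ b ((leftDel δ ^ k) D) := by
  change leftMul δ (monomial δ k b) D = _
  rw [leftMul_monomial]
  rfl

/-- The operators of order zero. -/
def of : B →+* DiffRing δ where
  __ := monomial δ 0
  map_one' := rfl
  map_mul' a b := by
    change monomial δ 0 (a * b) = monomial δ 0 a * monomial δ 0 b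
    rw [monomial_mul, pow_zero, AddMonoid.End.one_apply, leftCoeff_monomial]

/-- The operator `∂`. -/
def del : DiffRing δ := monomial δ 1 1

theorem del_mul_of (b : B) : del δ * of δ b = of δ (δ.toAddMonoidHom b) + of δ b * del δ := by
  change monomial δ 1 1 * monomial δ 0 b
    = monomial δ 0 (δ.toAddMonoidHom b) + monomial δ 0 b * monomial δ 1 1
  rw [monomial_mul, monomial_mul, pow_zero, pow_one, AddMonoid.End.one_apply, leftDel_monomial,
    map_add, leftCoeff_monomial, leftCoeff_monomial, leftCoeff_monomial, one_mul, one_mul, mul_one]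

theorem of_mul_del_pow (b : B) (k : ℕ) : of δ b * del δ ^ k = monomial δ k b := by
  have h : ∀ k, del δ ^ k = monomial δ k 1 := by
    intro k
    induction k with
    | zero => rfl
    | succ k ih =>
      rw [pow_succ', ih, del, monomial_mul, pow_one, leftDel_monomial, δ.map_one, map_zero,
        zero_add, leftCoeff_monomial, one_mul]
  rw [h]
  change monomial δ 0 b * _ = _
  rw [monomial_mul, pow_zero, AddMonoid.End.one_apply, leftCoeff_monomial, mul_one]

theorem coeff_of_mul_del_pow (b : B) (k l : ℕ) :
    (of δ b * del δ ^ k).coeff l = if k = l then b else 0 := by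
  rw [of_mul_del_pow]
  exact Finsupp.single_apply

end DiffRing

end DiffRing

section Operators

variable (K : Type*) [Field K]

/-- `d/du` on `K(u)`. -/
def scalarDeriv : RingDeriv (RatFunc K) where
  __ := (ratDeriv K : RatFunc K →ₗ[K] RatFunc K).toAddMonoidHom
  leibniz' a b := by
    change ratDeriv K (a * b) = ratDeriv K a * b + a * ratDeriv K b
    rw [Derivation.leibniz, smul_eq_mul, smul_eq_mul]
    ring

/-- `d/du` on rational functions of `u` with values in the `K`-algebra `A`. -/
def tensorDeriv (A : Type*) [Ring A] [Algebra K A] : RingDeriv (RatFunc K ⊗[K] A) where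
  __ := ((ratDeriv K : RatFunc K →ₗ[K] RatFunc K).rTensor A).toAddMonoidHom
  leibniz' b c := by
    change (ratDeriv K : RatFunc K →ₗ[K] RatFunc K).rTensor A (b * c)
      = (ratDeriv K : RatFunc K →ₗ[K] RatFunc K).rTensor A b * c
        + b * (ratDeriv K : RatFunc K →ₗ[K] RatFunc K).rTensor A c
    induction b using TensorProduct.induction_on with
    | zero => simp
    | add x y hx hy => simp only [add_mul, map_add, hx, hy]; abel
    | tmul f a =>
      induction c using TensorProduct.induction_on with
      | zero => simp
      | add x y hx hy => simp only [mul_add, map_add, hx, hy]; abel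
      | tmul g b =>
        simp only [Algebra.TensorProduct.tmul_mul_tmul, LinearMap.rTensor_tmul,
          Derivation.coeFn_coe, Derivation.leibniz, smul_eq_mul, ← TensorProduct.add_tmul]
        congr 1
        ring

/-- Scalar differential operators in one variable with rational coefficients. -/
abbrev ScalarOp : Type _ := DiffRing (scalarDeriv K)

/-- Differential operators in `u` whose coefficients are rational functions of `u` with values
in `A`. -/
abbrev DiffOp (A : Type*) [Ring A] [Algebra K A] : Type _ := DiffRing (tensorDeriv K A)

/-- The row determinant `∑ σ, sgn σ * a (1, σ 1) * ⋯ * a (n, σ n)`. -/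
def rdet {R : Type*} [Ring R] {n : ℕ} (a : Matrix (Fin n) (Fin n) R) : R :=
  ∑ σ : Equiv.Perm (Fin n),
    ((Equiv.Perm.sign σ : ℤ) : R) * (List.ofFn fun i => a i (σ i)).prod

end Operators

/-! ### The transfer matrices of the Gaudin model and the Bethe subalgebra -/

section Bethe

variable (K : Type*) [Field K] (M N : ℕ)

/-- `U(gl_M)`. -/
abbrev UGl : Type _ := UniversalEnvelopingAlgebra K (Matrix (Fin M) (Fin M) K)

/-- `U(gl_M) ⊗ ⋯ ⊗ U(gl_M)` (`N` factors). -/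
abbrev UGlTensor : Type _ := ⨂[K] _ : Fin N, UGl K M

variable {K M N} in
/-- `X ∈ gl_M` in the `a`-th tensor factor. -/
def inFactor (a : Fin N) (X : Matrix (Fin M) (Fin M) K) : UGlTensor K M N :=
  PiTensorProduct.singleAlgHom (R := K) (A := fun _ : Fin N => UGl K M) a
    (UniversalEnvelopingAlgebra.ι K X)

/-- The matrix with entries `(∂ᵤ - lam i) δ_ij - ∑ a, E_ji^(a) / (u - z a)`. -/
def gaudinMatrix (z : Fin N → K) (lam : Fin M → K) :
    Matrix (Fin M) (Fin M) (DiffOp K (UGlTensor K M N)) :=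
  fun i j =>
    (if i = j then DiffRing.del _ - DiffRing.of _ (algebraMap K _ (lam i)) else 0)
      - ∑ a : Fin N, DiffRing.of _
          ((RatFunc.X - RatFunc.C (z a))⁻¹ ⊗ₜ[K] inFactor a (Matrix.single j i 1))

/-- The row determinant of the Gaudin matrix. -/
def gaudinOp (z : Fin N → K) (lam : Fin M → K) : DiffOp K (UGlTensor K M N) :=
  rdet (gaudinMatrix K M N z lam)

/-- The `i`-th transfer matrix: the coefficient of `∂ᵤ ^ (M - i)` (used for `1 ≤ i ≤ M`). -/
def transferMatrix (z : Fin N → K) (lam : Fin M → K) (i : ℕ) :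
    RatFunc K ⊗[K] UGlTensor K M N :=
  (gaudinOp K M N z lam).coeff (M - i)

/-- The Bethe subalgebra: it is generated by the coefficients of the polynomials
`(∏ a, (u - z a) ^ i) * G_i(u)`, `1 ≤ i ≤ M`, where `G_i` is the `i`-th transfer matrix. -/
def betheSubalgebra (z : Fin N → K) (lam : Fin M → K) : Subalgebra K (UGlTensor K M N) :=
  Algebra.adjoin K
    {c | ∃ i : ℕ, 1 ≤ i ∧ i ≤ M ∧ ∃ P : Polynomial (UGlTensor K M N),
      (∏ a : Fin N, (RatFunc.X - RatFunc.C (z a)) ^ i : RatFunc K) • transferMatrix K M N z lam i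
          = P.sum (fun k p => (RatFunc.X ^ k : RatFunc K) ⊗ₜ[K] p) ∧
      ∃ k : ℕ, c = P.coeff k}

end Bethe

/-! ### The modules and the duality isomorphism -/

section Modules

variable (K : Type*) [Field K] (M N : ℕ)

/-- The operator by which `X ∈ gl_M` acts on `K[x_1, …, x_M]`, with `E_ij` acting as
`x_i ∂/∂x_j`, as a derivation. -/
def glDerivation : Matrix (Fin M) (Fin M) K →ₗ[K]
    Derivation K (MvPolynomial (Fin M) K) (MvPolynomial (Fin M) K) where
  toFun X := ∑ i, ∑ j, X i j • (MvPolynomial.X i : MvPolynomial (Fin M) K) • MvPolynomial.pderiv j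
  map_add' X Y := by simp [add_smul, Finset.sum_add_distrib]
  map_smul' c X := by simp [mul_smul, Finset.smul_sum]

theorem glDerivation_X (A : Matrix (Fin M) (Fin M) K) (k : Fin M) :
    glDerivation K M A (MvPolynomial.X k) = ∑ i, A i k • MvPolynomial.X i := by
  have hsum : ∀ f : Fin M → Derivation K (MvPolynomial (Fin M) K) (MvPolynomial (Fin M) K),
      (∑ i, f i) (MvPolynomial.X k) = ∑ i, f i (MvPolynomial.X k) := fun f => by
    rw [← Derivation.coeFnAddMonoidHom_apply, map_sum, Finset.sum_apply]
    rfl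
  simp [glDerivation, hsum, MvPolynomial.pderiv_X, Pi.single_apply]

theorem glDerivation_lie (A B : Matrix (Fin M) (Fin M) K) :
    glDerivation K M ⁅A, B⁆ = ⁅glDerivation K M A, glDerivation K M B⁆ := by
  have key : ∀ (A B : Matrix (Fin M) (Fin M) K) (k : Fin M),
      glDerivation K M A (glDerivation K M B (MvPolynomial.X k))
        = glDerivation K M (A * B) (MvPolynomial.X k) := by
    intro A B k
    simp only [glDerivation_X, map_sum, Derivation.map_smul, Finset.smul_sum, smul_smul,
      Matrix.mul_apply, Finset.sum_smul]
    rw [Finset.sum_comm]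
    simp only [mul_comm]
  apply MvPolynomial.derivation_ext
  intro k
  rw [Derivation.commutator_apply, key, key, Ring.lie_def, map_sub, Derivation.sub_apply]

/-- The representation of `gl_M` on `K[x_1, …, x_M]`. -/
def glRep : Matrix (Fin M) (Fin M) K →ₗ⁅K⁆ Module.End K (MvPolynomial (Fin M) K) where
  toFun X := (glDerivation K M X : MvPolynomial (Fin M) K →ₗ[K] MvPolynomial (Fin M) K)
  map_add' X Y := by rw [map_add]; rfl
  map_smul' c X := by rw [map_smul]; rfl
  map_lie' := by
    intro X Y
    simp only [glDerivation_lie]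
    rfl

/-- `K[x_1, …, x_M] ⊗ ⋯ ⊗ K[x_1, …, x_M]` (`N` factors). -/
abbrev PolyTensor : Type _ := ⨂[K] _ : Fin N, MvPolynomial (Fin M) K

/-- The action of `U(gl_M) ⊗ ⋯ ⊗ U(gl_M)` on the tensor product of the representations
`K[x_1, …, x_M]`, factor by factor. -/
def tensorAction : UGlTensor K M N →ₐ[K] Module.End K (PolyTensor K M N) :=
  PiTensorProduct.liftAlgHom
    ((PiTensorProduct.mapMultilinear K (fun _ : Fin N => MvPolynomial (Fin M) K)
        (fun _ : Fin N => MvPolynomial (Fin M) K)).compLinearMap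
      (fun _ => (UniversalEnvelopingAlgebra.lift K (glRep K M)).toLinearMap))
    (by simp)
    (by
      intro x y
      simp only [MultilinearMap.compLinearMap_apply, PiTensorProduct.mapMultilinear_apply,
        AlgHom.toLinearMap_apply, Pi.mul_apply, map_mul]
      exact PiTensorProduct.map_mul _ _)

/-- `⨂ b, L_{n b}` inside `⨂ b, K[x_1, …, x_M]`, where `L_d` is the space of homogeneous
polynomials of degree `d`. -/
def homTensor (n : Fin N → ℕ) : Submodule K (PolyTensor K M N) :=
  LinearMap.range (PiTensorProduct.mapIncl
    (fun b : Fin N => MvPolynomial.homogeneousSubmodule (Fin M) K (n b)))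

/-- The subspace of `⨂ b, L_{n b}` of vectors of weight `m`: a diagonal matrix
`diag (h 1, …, h M)` acts by the scalar `∑ i, m i * h i`. -/
def weightSpace (n : Fin N → ℕ) (m : Fin M → ℕ) : Submodule K (PolyTensor K M N) where
  carrier := {w | w ∈ homTensor K M N n ∧ ∀ h : Fin M → K,
    tensorAction K M N (∑ a : Fin N, inFactor a (Matrix.diagonal h)) w
      = (∑ i, (m i : K) * h i) • w}
  zero_mem' := ⟨zero_mem _, fun h => by simp⟩
  add_mem' hv hw := ⟨add_mem hv.1 hw.1, fun h => by rw [map_add, hv.2, hw.2, smul_add]⟩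
  smul_mem' c v hv := ⟨Submodule.smul_mem _ c hv.1, fun h => by rw [map_smul, hv.2, smul_comm]⟩

/-- The algebra homomorphism `K[x_1, …, x_M]^{⊗ N} → K[x_ij]` sending `x_i` in the `j`-th factor
to `x_ij`. -/
def polyHom : PolyTensor K M N →ₐ[K] MvPolynomial (Fin M × Fin N) K :=
  PiTensorProduct.liftAlgHom
    ((MultilinearMap.mkPiAlgebra K (Fin N) (MvPolynomial (Fin M × Fin N) K)).compLinearMap
      (fun j => (MvPolynomial.rename (fun i : Fin M => (i, j))).toLinearMap))
    (by simp)
    (by intro x y; simp [Finset.prod_mul_distrib])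

/-- `f ∈ K[x_1, …, x_M]` in the `j`-th tensor factor. -/
def polyInFactor (j : Fin N) : MvPolynomial (Fin M) K →ₐ[K] PolyTensor K M N :=
  PiTensorProduct.singleAlgHom (R := K) (A := fun _ : Fin N => MvPolynomial (Fin M) K) j

theorem polyHom_inFactor (j : Fin N) (f : MvPolynomial (Fin M) K) :
    polyHom K M N (polyInFactor K M N j f) = MvPolynomial.rename (fun i : Fin M => (i, j)) f := by
  have h : polyHom K M N (polyInFactor K M N j f) = ∏ b : Fin N,
      MvPolynomial.rename (fun i : Fin M => (i, b))
        ((Pi.mulSingle j f : Fin N → MvPolynomial (Fin M) K) b) :=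
    PiTensorProduct.lift.tprod _
  rw [h, Finset.prod_eq_single j]
  · simp
  · intro b _ hb
    simp [Pi.mulSingle_eq_of_ne hb]
  · simp

/-- The algebra isomorphism `K[x_1, …, x_M]^{⊗ N} ≃ K[x_ij]` sending `x_i` in the `j`-th factor
to `x_ij`. -/
def polyIso : PolyTensor K M N ≃ₐ[K] MvPolynomial (Fin M × Fin N) K :=
  AlgEquiv.ofAlgHom (polyHom K M N)
    (MvPolynomial.aeval fun ij : Fin M × Fin N => polyInFactor K M N ij.2 (MvPolynomial.X ij.1))
    (by
      apply MvPolynomial.algHom_ext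
      rintro ⟨i, j⟩
      simp [polyHom_inFactor])
    (by
      apply PiTensorProduct.algHom_ext
      intro j
      apply MvPolynomial.algHom_ext
      intro i
      change MvPolynomial.aeval _ (polyHom K M N (polyInFactor K M N j (MvPolynomial.X i)))
        = polyInFactor K M N j (MvPolynomial.X i)
      simp [polyHom_inFactor])

theorem polyIso_single (i : Fin M) (j : Fin N) :
    polyIso K M N (polyInFactor K M N j (MvPolynomial.X i)) = MvPolynomial.X (i, j) := by
  simp [polyIso, polyHom_inFactor]

/-- The duality isomorphism `K[x_1, …, x_M]^{⊗ N} ≃ K[x_ij] ≃ K[x_1, …, x_N]^{⊗ M}`, where the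
second identification sends `x_ij` to `x_j` in the `i`-th factor. -/
def dualityIso : PolyTensor K M N ≃ₐ[K] PolyTensor K N M :=
  (polyIso K M N).trans
    ((MvPolynomial.renameEquiv K (Equiv.prodComm (Fin M) (Fin N))).trans (polyIso K N M).symm)

/-- `w` is a common eigenvector of the Bethe subalgebra. -/
def IsBetheEigenvector (z : Fin N → K) (lam : Fin M → K) (w : PolyTensor K M N) : Prop :=
  w ≠ 0 ∧ ∀ g ∈ betheSubalgebra K M N z lam, ∃ c : K, tensorAction K M N g w = c • w

/-- The action on a vector `w` of a rational function of `u` with values in `U(gl_M)^{⊗ N}`; the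
result is a rational function with values in `K[x_1, …, x_M]^{⊗ N}`. -/
def actOn (g : RatFunc K ⊗[K] UGlTensor K M N) (w : PolyTensor K M N) :
    RatFunc K ⊗[K] PolyTensor K M N :=
  ((tensorAction K M N).toLinearMap.flip w).lTensor (RatFunc K) g

open Classical in
/-- The eigenvalue on `w` of the `i`-th transfer matrix, a rational function of `u`
(`0` if `w` is not an eigenvector). -/
def transferEigenvalue (z : Fin N → K) (lam : Fin M → K) (w : PolyTensor K M N) (i : ℕ) :
    RatFunc K :=
  if h : ∃ f : RatFunc K, actOn K M N (transferMatrix K M N z lam i) w = f ⊗ₜ[K] w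
  then h.choose else 0

/-- The monic scalar differential operator `D_w = ∂ᵤ ^ M + ∑_{i = 1}^M G_i^w(u) ∂ᵤ ^ (M - i)`,
where `G_i^w` is the eigenvalue on `w` of the `i`-th transfer matrix. -/
def scalarOp (z : Fin N → K) (lam : Fin M → K) (w : PolyTensor K M N) : ScalarOp K :=
  DiffRing.del _ ^ M + ∑ i ∈ Finset.Icc 1 M,
    DiffRing.of _ (transferEigenvalue K M N z lam w i) * DiffRing.del _ ^ (M - i)

end Modules

end BetheDuality

end

noncomputable section

namespace BetheDuality

attribute [local instance] LieRing.ofAssociativeRing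

/-! ### Row determinants of first order differential operators -/

section RowDeterminant

variable {K S : Type*} [Field K] [CommRing S] [Algebra K S] {n : ℕ}

/-! Both Bethe algebras act on $K[x_{ia}]$ by differential operators, and both row determinants come
from one commutative determinant. Write an operator on polynomials in normal order, with every
$x_{ia}$ to the left of every derivative, replace the derivatives by commuting symbols $y_{ia}$, and
replace $\partial_u$ by $p$. Left multiplication by an entry of the Gaudin matrix then acts on
symbols as multiplication by the symbol $g_{ij}=(p-\lambda_i)\delta_{ij}-\sum_a
x_{ja}y_{ia}/(u-z_a)$ plus a derivation $d_{ij}$, which collects the contractions of $\partial_u$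
and $\partial/\partial x_{ia}$ with what stands to the right.

A direct computation shows that $d_{ij}(g_{kl})$ is symmetric in $j$ and $l$
(`gaudinDeriv_gaudinSymbol`). In an alternating sum over permutations all contractions therefore
cancel in pairs (`rdet_firstOrder_one`), and the symbol of the row determinant is the ordinary
$\det(g_{ij})$ (`symbolAt_gaudinOp`).

By the Schur complement formula, $\prod_a(u-z_a)\det(g_{ij})$ is the determinant of the block matrix
with diagonal blocks $u-z$, $p-\lambda$ and off-diagonal blocks $x$, $y$ (`evalSymbol_capelliPoly`).
Transposing this matrix and exchanging its blocks exchanges the two Gaudin models together with $u$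
and $p$ (`swap_capelliPoly`). So the normally ordered coefficient of $u^ap^b$ is the same operator
on both sides.

On a Bethe eigenvector these operators act by scalars, because powers of $u$ are linearly
independent over $K$. The scalars are the numbers $A_{ab,w}$; read in the dual model, they give the
dual eigenvalues. The pole bound `gaudinOp_poleBound` links the generators of the Bethe subalgebra
with the coefficients of the row determinant. -/

theorem take_ofFn_congr {R : Type*} {f f' : Fin n → R} {k : ℕ}
    (h : ∀ i : Fin n, i.val < k → f i = f' i) :
    (List.ofFn f).take k = (List.ofFn f').take k := by
  apply List.ext_getElem
  · simp
  · intro i h1 h2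
    simp only [List.length_take, List.length_ofFn, lt_min_iff] at h1
    simp only [List.getElem_take, List.getElem_ofFn]
    exact h _ h1.1

theorem derivation_prod {ι : Type*} [DecidableEq ι] (d : Derivation K S S) (s : Finset ι)
    (f : ι → S) : d (∏ i ∈ s, f i) = ∑ l ∈ s, (∏ i ∈ s.erase l, f i) * d (f l) := by
  induction s using Finset.induction_on with
  | empty => simp
  | insert a s ha ih =>
    rw [Finset.prod_insert ha, Derivation.leibniz, ih, Finset.sum_insert ha,
      Finset.erase_insert ha, smul_eq_mul, smul_eq_mul, add_comm, Finset.mul_sum]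
    congr 1
    refine Finset.sum_congr rfl fun l hl => ?_
    have hne : a ≠ l := fun h => ha (h ▸ hl)
    rw [Finset.erase_insert_of_ne hne, Finset.prod_insert (by simp [ha]), mul_assoc]

theorem derivation_sum_apply {R A : Type*} [CommRing R] [CommRing A] [Algebra R A] {ι : Type*}
    (s : Finset ι) (d : ι → Derivation R A A) (r : A) : (∑ i ∈ s, d i) r = ∑ i ∈ s, d i r := by
  rw [← Derivation.coeFnAddMonoidHom_apply, map_sum, Finset.sum_apply]
  rfl

/-- The operators `g i j + d i j`, where `g i j` acts by multiplication. -/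
def firstOrder (g : Matrix (Fin n) (Fin n) S) (d : Fin n → Fin n → Derivation K S S) :
    Matrix (Fin n) (Fin n) (Module.End K S) :=
  fun i j => LinearMap.mulLeft K (g i j) + (d i j : S →ₗ[K] S)

/-- The summand of `σ` in the row determinant of `firstOrder g d` applied to `1`, with the
derivations omitted from the rows `k, k + 1, …`. -/
def partialTerm (g : Matrix (Fin n) (Fin n) S) (d : Fin n → Fin n → Derivation K S S) (k : ℕ)
    (σ : Equiv.Perm (Fin n)) : S :=
  ((List.ofFn fun i => firstOrder g d i (σ i)).take k).prod
    (∏ i ∈ Finset.univ.filter (fun i : Fin n => k ≤ i.val), g i (σ i))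

/-- By the Leibniz rule the derivation of row `k` hits one lower row `l` at a time. For fixed `l`,
the permutations `σ` and `σ * swap k l` give the same product up to sign: rows other than `k` and
`l` are unchanged, and the symmetry `h` identifies the contracted pair. The terms cancel. -/
theorem sum_derivation_eq_zero (g : Matrix (Fin n) (Fin n) S)
    (d : Fin n → Fin n → Derivation K S S)
    (h : ∀ i j k l, i < k → d i j (g k l) = d i l (g k j)) (k : Fin n) :
    ∑ σ : Equiv.Perm (Fin n), ((Equiv.Perm.sign σ : ℤ) : S) *
      ((List.ofFn fun i => firstOrder g d i (σ i)).take k.val).prod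
        (d k (σ k) (∏ i ∈ Finset.univ.filter (fun i : Fin n => k < i), g i (σ i))) = 0 := by
  simp only [derivation_prod, map_sum, Finset.mul_sum]
  rw [Finset.sum_comm]
  refine Finset.sum_eq_zero fun l hl => ?_
  have hkl : k < l := by simpa using hl
  refine Finset.sum_involution (fun σ _ => σ * Equiv.swap k l) ?_ ?_ ?_ ?_
  · intro σ _
    have h1 : ((List.ofFn fun i => firstOrder g d i ((σ * Equiv.swap k l) i)).take k.val)
        = (List.ofFn fun i => firstOrder g d i (σ i)).take k.val := by
      refine take_ofFn_congr fun i hi => ?_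
      have hik : i < k := hi
      rw [Equiv.Perm.mul_apply, Equiv.swap_apply_of_ne_of_ne hik.ne (hik.trans hkl).ne]
    have h2 : ∏ i ∈ (Finset.univ.filter (fun i : Fin n => k < i)).erase l,
          g i ((σ * Equiv.swap k l) i)
        = ∏ i ∈ (Finset.univ.filter (fun i : Fin n => k < i)).erase l, g i (σ i) := by
      refine Finset.prod_congr rfl fun i hi => ?_
      simp only [Finset.mem_erase, Finset.mem_filter, Finset.mem_univ, true_and] at hi
      rw [Equiv.Perm.mul_apply, Equiv.swap_apply_of_ne_of_ne hi.2.ne' hi.1]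
    rw [h1, h2]
    simp only [Equiv.Perm.mul_apply, Equiv.swap_apply_left, Equiv.swap_apply_right]
    rw [h k (σ l) l (σ k) hkl, Equiv.Perm.sign_mul, Equiv.Perm.sign_swap hkl.ne]
    push_cast
    ring
  -- The involution has no fixed points, since `k ≠ l`.
  · intro σ _ _ heq
    have h3 := congrArg (fun τ : Equiv.Perm (Fin n) => τ k) heq
    simp only [Equiv.Perm.mul_apply, Equiv.swap_apply_left] at h3
    exact hkl.ne' (σ.injective h3)
  · intro σ _
    exact Finset.mem_univ _
  · intro σ _
    simp [mul_assoc]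

/-- Passing from `k` to `k + 1` restores the derivation in row `k`. The difference of the two
partial terms is that derivation applied to the product of the rows below, then acted on by the rows
above, which is the sum that vanishes in `sum_derivation_eq_zero`. -/
theorem sum_partialTerm_succ (g : Matrix (Fin n) (Fin n) S)
    (d : Fin n → Fin n → Derivation K S S)
    (h : ∀ i j k l, i < k → d i j (g k l) = d i l (g k j)) (k : ℕ) (hk : k < n) :
    ∑ σ : Equiv.Perm (Fin n), ((Equiv.Perm.sign σ : ℤ) : S) * partialTerm g d (k + 1) σ
      = ∑ σ : Equiv.Perm (Fin n), ((Equiv.Perm.sign σ : ℤ) : S) * partialTerm g d k σ := by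
  rw [← sub_eq_zero, ← Finset.sum_sub_distrib]
  refine Eq.trans (Finset.sum_congr rfl fun σ _ => ?_) (sum_derivation_eq_zero g d h ⟨k, hk⟩)
  rw [← mul_sub]
  congr 1
  have hf : Finset.univ.filter (fun i : Fin n => k ≤ i.val)
      = insert ⟨k, hk⟩ (Finset.univ.filter (fun i : Fin n => (⟨k, hk⟩ : Fin n) < i)) := by
    ext i
    simp only [Finset.mem_filter, Finset.mem_univ, true_and, Finset.mem_insert, Fin.ext_iff,
      Fin.lt_def]
    omega
  have hf' : Finset.univ.filter (fun i : Fin n => k + 1 ≤ i.val)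
      = Finset.univ.filter (fun i : Fin n => (⟨k, hk⟩ : Fin n) < i) := by
    ext i
    simp only [Finset.mem_filter, Finset.mem_univ, true_and, Fin.lt_def]
    omega
  unfold partialTerm
  rw [hf, hf', Finset.prod_insert (by simp), List.take_add_one, List.prod_append,
    Module.End.mul_apply, ← map_sub]
  congr 1
  simp [firstOrder, hk]

/-- If `d i j (g k l)` is symmetric in `j` and `l`, the derivations do not contribute to the row
determinant of `g i j + d i j` applied to `1`. -/
theorem rdet_firstOrder_one (g : Matrix (Fin n) (Fin n) S)
    (d : Fin n → Fin n → Derivation K S S)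
    (h : ∀ i j k l, i < k → d i j (g k l) = d i l (g k j)) :
    rdet (firstOrder g d) 1 = g.det := by
  have hind : ∀ k ≤ n, ∑ σ : Equiv.Perm (Fin n),
      ((Equiv.Perm.sign σ : ℤ) : S) * partialTerm g d k σ = g.det := by
    intro k
    induction k with
    | zero =>
      intro _
      -- With all derivations omitted this is the Leibniz formula; the transpose accounts for the
      -- convention `A (σ i) i` in `Matrix.det_apply'`.
      rw [← Matrix.det_transpose, Matrix.det_apply']
      simp [partialTerm]
    | succ k ih =>
      intro hk
      rw [sum_partialTerm_succ g d h k hk, ih (by omega)]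
  rw [← hind n le_rfl, rdet, LinearMap.sum_apply]
  refine Finset.sum_congr rfl fun σ _ => ?_
  -- At `k = n` no row is left without its derivation, so the partial term is the full row product
  -- applied to `1`.
  have hfil : Finset.univ.filter (fun i : Fin n => n ≤ i.val) = ∅ := by
    ext i
    simp
  rw [partialTerm, hfil, Finset.prod_empty, List.take_of_length_le (by simp), ← zsmul_eq_mul,
    ← zsmul_eq_mul, LinearMap.smul_apply]

end RowDeterminant

/-! ### Derivations of tensor products -/

section TensorDerivation

variable {K A B : Type*} [Field K] [CommRing A] [Algebra K A] [CommRing B] [Algebra K B]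

/-- The derivation `d ⊗ 1` of `A ⊗ B`. -/
def derivLeft (B : Type*) [CommRing B] [Algebra K B] (d : Derivation K A A) :
    Derivation K (A ⊗[K] B) (A ⊗[K] B) :=
  Derivation.mk' ((d : A →ₗ[K] A).rTensor B) fun b c => by
    induction b using TensorProduct.induction_on with
    | zero => simp
    | add x y hx hy => simp only [add_mul, map_add, hx, hy, smul_eq_mul, mul_add]; ring
    | tmul f a =>
      induction c using TensorProduct.induction_on with
      | zero => simp
      | add x y hx hy => simp only [mul_add, map_add, hx, hy, smul_eq_mul, add_mul]; ring
      | tmul g b =>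
        simp only [Algebra.TensorProduct.tmul_mul_tmul, LinearMap.rTensor_tmul,
          Derivation.coeFn_coe, Derivation.leibniz, smul_eq_mul, TensorProduct.add_tmul,
          mul_comm b a]

/-- The derivation `1 ⊗ d` of `A ⊗ B`. -/
def derivRight (A : Type*) [CommRing A] [Algebra K A] (d : Derivation K B B) :
    Derivation K (A ⊗[K] B) (A ⊗[K] B) :=
  Derivation.mk' ((d : B →ₗ[K] B).lTensor A) fun b c => by
    induction b using TensorProduct.induction_on with
    | zero => simp
    | add x y hx hy => simp only [add_mul, map_add, hx, hy, smul_eq_mul, mul_add]; ring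
    | tmul f a =>
      induction c using TensorProduct.induction_on with
      | zero => simp
      | add x y hx hy => simp only [mul_add, map_add, hx, hy, smul_eq_mul, add_mul]; ring
      | tmul g b =>
        simp only [Algebra.TensorProduct.tmul_mul_tmul, LinearMap.lTensor_tmul,
          Derivation.coeFn_coe, Derivation.leibniz, smul_eq_mul, TensorProduct.tmul_add,
          mul_comm g f]

@[simp]
theorem derivLeft_tmul (d : Derivation K A A) (a : A) (b : B) :
    derivLeft B d (a ⊗ₜ[K] b) = d a ⊗ₜ b := rfl

@[simp]
theorem derivRight_tmul (d : Derivation K B B) (a : A) (b : B) :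
    derivRight A d (a ⊗ₜ[K] b) = a ⊗ₜ d b := rfl

end TensorDerivation

section DifferentialOperators

open DiffRing

/-! ### Coefficients of differential operators -/

namespace DiffRing

variable {B : Type*} [Ring B] (δ : RingDeriv B)

/-- The coefficient of `∂ ^ k` as an additive map. -/
def coeffHom (k : ℕ) : DiffRing δ →+ B := Finsupp.applyAddHom k

theorem coeffHom_apply (k : ℕ) (D : DiffRing δ) : coeffHom δ k D = D.coeff k := rfl

theorem coeff_monomial (k l : ℕ) (b : B) :
    (monomial δ k b).coeff l = if k = l then b else 0 :=
  Finsupp.single_apply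

theorem coeff_of_mul (b : B) (D : DiffRing δ) (k : ℕ) : (of δ b * D).coeff k = b * D.coeff k := by
  have h : (coeffHom δ k).comp (AddMonoidHom.mulLeft (of δ b))
      = (AddMonoidHom.mulLeft b).comp (coeffHom δ k) :=
    hom_ext δ fun l c => by
      change (monomial δ 0 b * monomial δ l c).coeff k = b * (monomial δ l c).coeff k
      rw [monomial_mul, pow_zero, AddMonoid.End.one_apply, leftCoeff_monomial, coeff_monomial,
        coeff_monomial, mul_ite, mul_zero]
  exact DFunLike.congr_fun h D

theorem del_mul_monomial (k : ℕ) (b : B) :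
    del δ * monomial δ k b = monomial δ k (δ.toAddMonoidHom b) + monomial δ (k + 1) b := by
  rw [del, monomial_mul, pow_one, leftDel_monomial, map_add, leftCoeff_monomial,
    leftCoeff_monomial, one_mul, one_mul]

theorem of_mul_monomial (a : B) (k : ℕ) (b : B) :
    of δ a * monomial δ k b = monomial δ k (a * b) := by
  change monomial δ 0 a * _ = _
  rw [monomial_mul, pow_zero, AddMonoid.End.one_apply, leftCoeff_monomial]

theorem coeff_del_mul_succ (D : DiffRing δ) (k : ℕ) :
    (del δ * D).coeff (k + 1) = δ.toAddMonoidHom (D.coeff (k + 1)) + D.coeff k := by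
  have h : (coeffHom δ (k + 1)).comp (AddMonoidHom.mulLeft (del δ))
      = δ.toAddMonoidHom.comp (coeffHom δ (k + 1)) + coeffHom δ k :=
    hom_ext δ fun l c => by
      change (del δ * monomial δ l c).coeff (k + 1)
        = δ.toAddMonoidHom ((monomial δ l c).coeff (k + 1)) + (monomial δ l c).coeff k
      rw [del_mul_monomial, ← coeffHom_apply, map_add, coeffHom_apply, coeffHom_apply,
        coeff_monomial, coeff_monomial, coeff_monomial, coeff_monomial,
        apply_ite δ.toAddMonoidHom, map_zero]
      simp
  exact DFunLike.congr_fun h D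

theorem coeff_del_mul_zero (D : DiffRing δ) :
    (del δ * D).coeff 0 = δ.toAddMonoidHom (D.coeff 0) := by
  have h : (coeffHom δ 0).comp (AddMonoidHom.mulLeft (del δ))
      = δ.toAddMonoidHom.comp (coeffHom δ 0) :=
    hom_ext δ fun l c => by
      change (del δ * monomial δ l c).coeff 0 = δ.toAddMonoidHom ((monomial δ l c).coeff 0)
      rw [del_mul_monomial, ← coeffHom_apply, map_add, coeffHom_apply, coeffHom_apply,
        coeff_monomial, coeff_monomial, coeff_monomial, apply_ite δ.toAddMonoidHom, map_zero]
      simp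
  exact DFunLike.congr_fun h D

theorem ext_coeff {D E : DiffRing δ} (h : ∀ k, D.coeff k = E.coeff k) : D = E :=
  Finsupp.ext h

theorem coeff_add (D E : DiffRing δ) (k : ℕ) : (D + E).coeff k = D.coeff k + E.coeff k := rfl

theorem coeff_sub (D E : DiffRing δ) (k : ℕ) : (D - E).coeff k = D.coeff k - E.coeff k :=
  map_sub (coeffHom δ k) D E

theorem coeff_sum {ι : Type*} (s : Finset ι) (f : ι → DiffRing δ) (k : ℕ) :
    (∑ i ∈ s, f i).coeff k = ∑ i ∈ s, (f i).coeff k :=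
  map_sum (coeffHom δ k) f s

theorem coeff_zsmul (c : ℤ) (D : DiffRing δ) (k : ℕ) : (c • D).coeff k = c • D.coeff k :=
  map_zsmul (coeffHom δ k) c D

theorem coeff_one (k : ℕ) : (1 : DiffRing δ).coeff k = if 0 = k then 1 else 0 :=
  coeff_monomial δ 0 k 1

end DiffRing

/-! ### Poles of the coefficients -/

section Poles

variable {K : Type*} [Field K] {A : Type*} [Ring A] [Algebra K A]

variable (K A) in
/-- The polynomials in `u` with values in `A`, among the rational functions. -/
def polynomialValued : Subalgebra K (RatFunc K ⊗[K] A) :=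
  (Algebra.TensorProduct.map (IsScalarTower.toAlgHom K (Polynomial K) (RatFunc K))
    (AlgHom.id K A)).range

theorem tmul_mem_polynomialValued (p : Polynomial K) (a : A) :
    algebraMap (Polynomial K) (RatFunc K) p ⊗ₜ[K] a ∈ polynomialValued K A :=
  ⟨p ⊗ₜ a, rfl⟩

theorem polynomialValued_induction
    {motive : ∀ x : RatFunc K ⊗[K] A, x ∈ polynomialValued K A → Prop}
    (zero : motive 0 (zero_mem _))
    (add : ∀ x y hx hy, motive x hx → motive y hy → motive (x + y) (add_mem hx hy))
    (tmul : ∀ (p : Polynomial K) (a : A),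
      motive (algebraMap (Polynomial K) (RatFunc K) p ⊗ₜ[K] a) (tmul_mem_polynomialValued p a))
    {x : RatFunc K ⊗[K] A} (hx : x ∈ polynomialValued K A) : motive x hx := by
  obtain ⟨t, rfl⟩ := hx
  induction t using TensorProduct.induction_on with
  | zero => simpa using zero
  | add a b ha hb => simpa using add _ _ _ _ ha hb
  | tmul p a => exact tmul p a

theorem smul_mem_polynomialValued (p : Polynomial K) {x : RatFunc K ⊗[K] A}
    (hx : x ∈ polynomialValued K A) :
    algebraMap (Polynomial K) (RatFunc K) p • x ∈ polynomialValued K A := by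
  induction hx using polynomialValued_induction with
  | zero => simp
  | add a b _ _ ha hb => rw [smul_add]; exact add_mem ha hb
  | tmul q a =>
    rw [TensorProduct.smul_tmul', smul_eq_mul, ← map_mul]
    exact tmul_mem_polynomialValued _ _

theorem tensorDeriv_tmul (f : RatFunc K) (a : A) :
    (tensorDeriv K A).toAddMonoidHom (f ⊗ₜ[K] a) = ratDeriv K f ⊗ₜ a := rfl

theorem deriv_mem_polynomialValued {x : RatFunc K ⊗[K] A} (hx : x ∈ polynomialValued K A) :
    (tensorDeriv K A).toAddMonoidHom x ∈ polynomialValued K A := by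
  induction hx using polynomialValued_induction with
  | zero => rw [map_zero]; exact zero_mem _
  | add a b _ _ ha hb => rw [map_add]; exact add_mem ha hb
  | tmul q a =>
    rw [tensorDeriv_tmul, ratDeriv_algebraMap]
    exact tmul_mem_polynomialValued _ _

theorem tensorDeriv_smul (f : RatFunc K) (x : RatFunc K ⊗[K] A) :
    (tensorDeriv K A).toAddMonoidHom (f • x)
      = ratDeriv K f • x + f • (tensorDeriv K A).toAddMonoidHom x := by
  induction x using TensorProduct.induction_on with
  | zero => simp
  | add x y hx hy => simp only [smul_add, map_add, hx, hy]; abel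
  | tmul g a =>
    simp only [TensorProduct.smul_tmul', tensorDeriv_tmul, smul_eq_mul, Derivation.leibniz,
      ← TensorProduct.add_tmul]
    congr 1
    ring

/-- Differentiation costs one power of `q`: if `q ^ e • x` is polynomial, then the left side and the
first summand on the right are polynomial, hence so is `q ^ (e + 1) • x'`. -/
theorem smul_tensorDeriv_pow_smul (q : Polynomial K) (e : ℕ) (x : RatFunc K ⊗[K] A) :
    algebraMap (Polynomial K) (RatFunc K) q • (tensorDeriv K A).toAddMonoidHom
        (algebraMap (Polynomial K) (RatFunc K) q ^ e • x)
      = algebraMap (Polynomial K) (RatFunc K) (e • Polynomial.derivative q) •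
          algebraMap (Polynomial K) (RatFunc K) q ^ e • x
        + algebraMap (Polynomial K) (RatFunc K) q ^ (e + 1) •
          (tensorDeriv K A).toAddMonoidHom x := by
  rw [tensorDeriv_smul, smul_add, smul_smul, smul_smul, smul_smul, ← pow_succ',
    Derivation.leibniz_pow, ratDeriv_algebraMap]
  congr 2
  -- The rule for the derivative of a power contains the truncated exponent `e - 1`, so `e = 0` is
  -- treated separately.
  cases e with
  | zero => simp
  | succ e =>
    simp only [nsmul_eq_mul, smul_eq_mul, map_mul, map_natCast, Nat.add_sub_cancel]
    ring

/-- This supplies the form in which `betheSubalgebra` presents the polynomials whose coefficients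
generate it. -/
theorem exists_polynomial_of_mem {x : RatFunc K ⊗[K] A} (hx : x ∈ polynomialValued K A) :
    ∃ P : Polynomial A, x = P.sum fun k p => (RatFunc.X ^ k : RatFunc K) ⊗ₜ[K] p := by
  let Φ : Polynomial A →+ RatFunc K ⊗[K] A :=
    { toFun := fun P => P.sum fun k p => (RatFunc.X ^ k : RatFunc K) ⊗ₜ[K] p
      map_zero' := by simp
      map_add' := fun P Q => Polynomial.sum_add_index P Q _ (by simp)
        (fun k a b => TensorProduct.tmul_add _ _ _) }
  change ∃ P, x = Φ P
  induction hx using polynomialValued_induction with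
  | zero => exact ⟨0, (map_zero Φ).symm⟩
  | add a b _ _ ha hb =>
    obtain ⟨P, rfl⟩ := ha
    obtain ⟨Q, rfl⟩ := hb
    exact ⟨P + Q, (map_add Φ P Q).symm⟩
  | tmul q a =>
    induction q using Polynomial.induction_on' with
    | add p q hp hq =>
      obtain ⟨P, hP⟩ := hp
      obtain ⟨Q, hQ⟩ := hq
      exact ⟨P + Q, by rw [map_add, map_add, TensorProduct.add_tmul, hP, hQ]⟩
    | monomial k c =>
      refine ⟨Polynomial.monomial k (c • a), ?_⟩
      change _ = (Polynomial.monomial k (c • a)).sum _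
      rw [Polynomial.sum_monomial_index _ _ (by simp), TensorProduct.tmul_smul,
        TensorProduct.smul_tmul', ← Polynomial.C_mul_X_pow_eq_monomial, map_mul, map_pow,
        RatFunc.algebraMap_X, RatFunc.algebraMap_C, RatFunc.smul_eq_C_mul]

variable (q : Polynomial K)

/-- `D` has order at most `d`, and the coefficient of `∂ ^ k` becomes polynomial after
multiplication by `q ^ (d - k)`. -/
def PoleBound (d : ℕ) (D : DiffOp K A) : Prop :=
  (∀ k, d < k → D.coeff k = 0) ∧
    ∀ k ≤ d, algebraMap (Polynomial K) (RatFunc K) q ^ (d - k) • D.coeff k ∈ polynomialValued K A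

variable {q}

theorem PoleBound.add {d : ℕ} {D E : DiffOp K A} (hD : PoleBound q d D) (hE : PoleBound q d E) :
    PoleBound q d (D + E) :=
  ⟨fun k hk => by rw [coeff_add, hD.1 k hk, hE.1 k hk, add_zero],
    fun k hk => by rw [coeff_add, smul_add]; exact add_mem (hD.2 k hk) (hE.2 k hk)⟩

theorem PoleBound.zsmul {d : ℕ} {D : DiffOp K A} (hD : PoleBound q d D) (c : ℤ) :
    PoleBound q d (c • D) :=
  ⟨fun k hk => by rw [coeff_zsmul, hD.1 k hk, smul_zero],
    fun k hk => by rw [coeff_zsmul, smul_comm]; exact zsmul_mem (hD.2 k hk) c⟩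

theorem poleBound_zero (d : ℕ) : PoleBound q d (0 : DiffOp K A) := by
  have h : ∀ k, (0 : DiffOp K A).coeff k = 0 := fun _ => rfl
  exact ⟨fun k _ => h k, fun k _ => by rw [h, smul_zero]; exact zero_mem _⟩

theorem PoleBound.sum {d : ℕ} {ι : Type*} (s : Finset ι) {f : ι → DiffOp K A}
    (h : ∀ i ∈ s, PoleBound q d (f i)) : PoleBound q d (∑ i ∈ s, f i) :=
  Finset.sum_induction f (PoleBound q d) (fun _ _ => PoleBound.add) (poleBound_zero d) h

theorem PoleBound.of_mul {d : ℕ} {D : DiffOp K A} (hD : PoleBound q d D) {b : RatFunc K ⊗[K] A}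
    (hb : algebraMap (Polynomial K) (RatFunc K) q • b ∈ polynomialValued K A) :
    PoleBound q (d + 1) (of (tensorDeriv K A) b * D) := by
  refine ⟨fun k hk => by rw [coeff_of_mul, hD.1 k (by omega), mul_zero], fun k hk => ?_⟩
  rw [coeff_of_mul]
  -- The only case with `d < k` is `k = d + 1`, where the coefficient is zero.
  rcases Nat.lt_or_ge d k with h | h
  · rw [hD.1 k h, mul_zero, smul_zero]
    exact zero_mem _
  · rw [Nat.sub_add_comm h, pow_succ', mul_smul, ← mul_smul_comm, ← smul_mul_assoc]
    exact mul_mem hb (hD.2 k h)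

theorem PoleBound.del_mul {d : ℕ} {D : DiffOp K A} (hD : PoleBound q d D) :
    PoleBound q (d + 1) (del (tensorDeriv K A) * D) := by
  have key : ∀ k ≤ d, algebraMap (Polynomial K) (RatFunc K) q ^ (d + 1 - k) •
      (tensorDeriv K A).toAddMonoidHom (D.coeff k) ∈ polynomialValued K A := by
    intro k hk
    have h1 := sub_mem (smul_mem_polynomialValued q (deriv_mem_polynomialValued (hD.2 k hk)))
      (smul_mem_polynomialValued ((d - k : ℕ) • Polynomial.derivative q) (hD.2 k hk))
    rw [smul_tensorDeriv_pow_smul, add_sub_cancel_left, ← Nat.sub_add_comm hk] at h1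
    exact h1
  refine ⟨fun k hk => ?_, fun k hk => ?_⟩
  · obtain ⟨k, rfl⟩ := Nat.exists_eq_add_of_le' (Nat.one_le_of_lt hk)
    rw [coeff_del_mul_succ, hD.1 (k + 1) (by omega), hD.1 k (by omega), map_zero, zero_add]
  · cases k with
    | zero =>
      rw [coeff_del_mul_zero]
      exact key 0 (Nat.zero_le _)
    | succ k =>
      rw [coeff_del_mul_succ, smul_add]
      refine add_mem ?_ ?_
      · rcases Nat.lt_or_ge d (k + 1) with h | h
        · rw [hD.1 _ h, map_zero, smul_zero]
          exact zero_mem _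
        · exact key _ h
      · rw [Nat.add_sub_add_right]
        exact hD.2 k (by omega)

/-- Each factor behaves like `ε i * ∂` plus terms of order zero with at most one power of `q` in the
denominator. The hypothesis concerns left multiplication because the induction removes the leftmost
factor. -/
theorem coeff_prod_ofFn {n : ℕ} (e : Fin n → DiffOp K A) (ε : Fin n → ℤ)
    (he : ∀ i d D, PoleBound q d D → PoleBound q (d + 1) (e i * D) ∧
      (e i * D).coeff (d + 1) = ε i • D.coeff d) :
    PoleBound q n (List.ofFn e).prod ∧ (List.ofFn e).prod.coeff n = (∏ i, ε i) • 1 := by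
  induction n with
  | zero =>
    rw [List.ofFn_zero, List.prod_nil, Fin.prod_univ_zero, one_smul, coeff_one]
    refine ⟨⟨fun k hk => by rw [coeff_one, if_neg hk.ne], fun k hk => ?_⟩, if_pos rfl⟩
    obtain rfl : k = 0 := Nat.le_zero.mp hk
    rw [coeff_one, if_pos rfl, Nat.sub_zero, pow_zero, one_smul]
    exact one_mem _
  | succ n ih =>
    obtain ⟨h1, h2⟩ := ih (fun i => e i.succ) (fun i => ε i.succ) (fun i => he i.succ)
    rw [List.ofFn_succ, List.prod_cons, Fin.prod_univ_succ, mul_smul, ← h2]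
    exact he 0 n _ h1

end Poles

/-! ### Order, leading coefficient and poles of the Gaudin row determinant. -/

section GaudinPoles

variable {K : Type*} [Field K] {M N : ℕ} (z : Fin N → K) (lam : Fin M → K)

/-- The common denominator `∏ a, (u - z a)`. -/
def nodePoly : Polynomial K := ∏ a : Fin N, (Polynomial.X - Polynomial.C (z a))

theorem algebraMap_nodePoly : algebraMap (Polynomial K) (RatFunc K) (nodePoly z)
    = ∏ a : Fin N, (RatFunc.X - RatFunc.C (z a)) := by
  simp [nodePoly, map_prod, RatFunc.algebraMap_X, RatFunc.algebraMap_C]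

theorem X_sub_C_ne_zero (c : K) : (RatFunc.X - RatFunc.C c : RatFunc K) ≠ 0 := by
  rw [← RatFunc.algebraMap_X, ← RatFunc.algebraMap_C, ← map_sub]
  exact RatFunc.algebraMap_ne_zero (Polynomial.X_sub_C_ne_zero c)

theorem nodePoly_smul_mem {A : Type*} [Ring A] [Algebra K A] (a : Fin N) (x : A) :
    algebraMap (Polynomial K) (RatFunc K) (nodePoly z) •
      ((RatFunc.X - RatFunc.C (z a))⁻¹ ⊗ₜ[K] x) ∈ polynomialValued K A := by
  have h : algebraMap (Polynomial K) (RatFunc K) (nodePoly z) * (RatFunc.X - RatFunc.C (z a))⁻¹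
      = algebraMap (Polynomial K) (RatFunc K)
        (∏ b ∈ Finset.univ.erase a, (Polynomial.X - Polynomial.C (z b))) := by
    rw [mul_inv_eq_iff_eq_mul₀ (X_sub_C_ne_zero _), nodePoly,
      ← Finset.prod_erase_mul _ _ (Finset.mem_univ a), map_mul, map_sub, RatFunc.algebraMap_X,
      RatFunc.algebraMap_C]
  rw [TensorProduct.smul_tmul', smul_eq_mul, h]
  exact tmul_mem_polynomialValued _ _

theorem gaudinMatrix_mul_poleBound (i j : Fin M) (d : ℕ) (D : DiffOp K (UGlTensor K M N))
    (hD : PoleBound (nodePoly z) d D) :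
    PoleBound (nodePoly z) (d + 1) (gaudinMatrix K M N z lam i j * D) ∧
      (gaudinMatrix K M N z lam i j * D).coeff (d + 1)
        = (1 : Matrix (Fin M) (Fin M) ℤ) i j • D.coeff d := by
  have hneg : ∀ {E F : DiffOp K (UGlTensor K M N)}, PoleBound (nodePoly z) (d + 1) E →
      PoleBound (nodePoly z) (d + 1) F → PoleBound (nodePoly z) (d + 1) (E - F) := by
    intro E F hE hF
    have := hE.add (hF.zsmul (-1))
    rwa [neg_one_zsmul, ← sub_eq_add_neg] at this
  have hconst : PoleBound (nodePoly z) (d + 1)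
      (of (tensorDeriv K _) (algebraMap K (RatFunc K ⊗[K] UGlTensor K M N) (lam i)) * D) :=
    hD.of_mul (smul_mem_polynomialValued _ (Subalgebra.algebraMap_mem _ _))
  have hres : ∀ a : Fin N, PoleBound (nodePoly z) (d + 1)
      (of (tensorDeriv K (UGlTensor K M N)) ((RatFunc.X - RatFunc.C (z a))⁻¹ ⊗ₜ[K]
        inFactor a (Matrix.single j i 1)) * D) :=
    fun a => hD.of_mul (nodePoly_smul_mem z a _)
  have hzero : ∀ b, (of (tensorDeriv K (UGlTensor K M N)) b * D).coeff (d + 1) = 0 := by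
    intro b
    rw [coeff_of_mul, hD.1 _ (Nat.lt_succ_self d), mul_zero]
  unfold gaudinMatrix
  rw [sub_mul, Finset.sum_mul]
  refine ⟨hneg ?_ (PoleBound.sum _ fun a _ => hres a), ?_⟩
  · split_ifs
    · rw [sub_mul]
      exact hneg hD.del_mul hconst
    · rw [zero_mul]
      exact poleBound_zero _
  · rw [coeff_sub, coeff_sum, Finset.sum_eq_zero fun a _ => hzero _, sub_zero]
    split_ifs with hij
    · rw [sub_mul, coeff_sub, hzero, sub_zero, coeff_del_mul_succ,
        hD.1 _ (Nat.lt_succ_self d), map_zero, zero_add, hij, Matrix.one_apply_eq, one_smul]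
    · rw [zero_mul, Matrix.one_apply_ne hij, zero_smul]
      rfl

/-- This makes `G_i(u) ∏ a, (u - z a) ^ i` a polynomial, so that the Bethe subalgebra really
contains generators coming from every `G_i`. -/
theorem gaudinOp_poleBound : PoleBound (nodePoly z) M (gaudinOp K M N z lam) := by
  unfold gaudinOp rdet
  refine PoleBound.sum _ fun σ _ => ?_
  rw [← zsmul_eq_mul]
  exact (coeff_prod_ofFn _ _ fun i =>
    gaudinMatrix_mul_poleBound z lam i (σ i)).1.zsmul _

/-- Only the diagonal entries contain `∂`, with coefficient one, so the leading coefficient is the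
determinant of the identity matrix. -/
theorem gaudinOp_coeff_top : (gaudinOp K M N z lam).coeff M = 1 := by
  have h : ∀ σ : Equiv.Perm (Fin M), (((Equiv.Perm.sign σ : ℤ) : DiffOp K (UGlTensor K M N)) *
      (List.ofFn fun i => gaudinMatrix K M N z lam i (σ i)).prod).coeff M
      = ((Equiv.Perm.sign σ : ℤ) * ∏ i, (1 : Matrix (Fin M) (Fin M) ℤ) i (σ i)) • 1 := by
    intro σ
    rw [← zsmul_eq_mul, coeff_zsmul, mul_smul]
    exact congrArg _ (coeff_prod_ofFn _ _ fun i => gaudinMatrix_mul_poleBound z lam i (σ i)).2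
  have hdet := Matrix.det_apply' (1 : Matrix (Fin M) (Fin M) ℤ).transpose
  rw [Matrix.transpose_one, Matrix.det_one] at hdet
  unfold gaudinOp rdet
  rw [coeff_sum, Finset.sum_congr rfl fun σ _ => h σ, ← Finset.sum_smul]
  convert one_smul ℤ _
  rw [hdet]
  simp [Matrix.one_apply, eq_comm]

end GaudinPoles

/-! ### Comparison of coefficients -/

section Comparison

variable {K : Type*} [Field K] {W : Type*} [AddCommGroup W] [Module K W]

/-- Powers of `u` are linearly independent over `K`; a linear functional on `W` reduces the claim to
a polynomial identity. -/
theorem eq_zero_of_sum_pow_tmul {n : ℕ} {v : ℕ → W}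
    (h : ∑ a ∈ Finset.range n, (RatFunc.X ^ a : RatFunc K) ⊗ₜ[K] v a = 0) {a : ℕ} (ha : a < n) :
    v a = 0 := by
  rw [← Module.forall_dual_apply_eq_zero_iff K]
  intro φ
  have h1 := congrArg (TensorProduct.rid K (RatFunc K) ∘ φ.lTensor (RatFunc K)) h
  simp only [Function.comp_apply, map_sum, LinearMap.lTensor_tmul, TensorProduct.rid_tmul,
    map_zero] at h1
  have h2 : algebraMap (Polynomial K) (RatFunc K)
      (∑ a ∈ Finset.range n, Polynomial.monomial a (φ (v a))) = 0 := by
    rw [map_sum, ← h1]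
    refine Finset.sum_congr rfl fun b _ => ?_
    rw [← Polynomial.C_mul_X_pow_eq_monomial, map_mul, map_pow, RatFunc.algebraMap_X,
      RatFunc.algebraMap_C, RatFunc.smul_eq_C_mul]
  have h3 := congrArg (fun p => Polynomial.coeff p a)
    ((map_eq_zero_iff _ (RatFunc.algebraMap_injective K)).mp h2)
  simpa [Polynomial.finsetSum_coeff, Polynomial.coeff_monomial, ha] using h3

/-- Modulo the line spanned by `w` the right side vanishes, so every `v a` vanishes there too. -/
theorem exists_smul_of_sum_pow_tmul {n : ℕ} {v : ℕ → W} {h : RatFunc K} {w : W}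
    (hv : ∑ a ∈ Finset.range n, (RatFunc.X ^ a : RatFunc K) ⊗ₜ[K] v a = h ⊗ₜ w) {a : ℕ}
    (ha : a < n) : ∃ c : K, v a = c • w := by
  have h1 := congrArg ((K ∙ w).mkQ.lTensor (RatFunc K)) hv
  have hw : (K ∙ w).mkQ w = 0 := by simp
  simp only [map_sum, LinearMap.lTensor_tmul, hw, TensorProduct.tmul_zero] at h1
  have h2 := eq_zero_of_sum_pow_tmul (v := fun a => (K ∙ w).mkQ (v a)) h1 ha
  simp only [Submodule.mkQ_apply, Submodule.Quotient.mk_eq_zero,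
    Submodule.mem_span_singleton] at h2
  obtain ⟨c, hc⟩ := h2
  exact ⟨c, hc.symm⟩

theorem tmul_right_injective {w : W} (hw : w ≠ 0) {f g : RatFunc K}
    (h : f ⊗ₜ[K] w = g ⊗ₜ[K] w) : f = g := by
  obtain ⟨φ, hφ⟩ : ∃ φ : Module.Dual K W, φ w ≠ 0 := by
    by_contra! hcon
    exact hw ((Module.forall_dual_apply_eq_zero_iff K w).mp hcon)
  have h1 := congrArg (TensorProduct.rid K (RatFunc K) ∘ φ.lTensor (RatFunc K)) h
  simp only [Function.comp_apply, LinearMap.lTensor_tmul, TensorProduct.rid_tmul] at h1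
  exact smul_right_injective _ hφ h1

/-- The variable `p` is only ever specialised to scalars `c`. Over an infinite field these
specialisations determine the coefficients of the powers of `p`. -/
theorem eq_of_sum_pow_smul [Infinite K] {n : ℕ} {v v' : ℕ → W}
    (h : ∀ c : K, ∑ k ∈ Finset.range n, c ^ k • v k = ∑ k ∈ Finset.range n, c ^ k • v' k) {k : ℕ}
    (hk : k < n) : v k = v' k := by
  rw [← sub_eq_zero, ← Module.forall_dual_apply_eq_zero_iff K]
  intro φ
  have h2 : ∑ k ∈ Finset.range n, Polynomial.monomial k (φ (v k - v' k)) = 0 := by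
    refine Polynomial.funext fun c => ?_
    have h3 := congrArg φ (sub_eq_zero.mpr (h c))
    rw [← Finset.sum_sub_distrib, map_sum, map_zero] at h3
    rw [Polynomial.eval_finsetSum, Polynomial.eval_zero, ← h3]
    refine Finset.sum_congr rfl fun k _ => ?_
    rw [Polynomial.eval_monomial, ← smul_sub, map_smul, smul_eq_mul, mul_comm]
  have h3 := congrArg (fun p => Polynomial.coeff p k) h2
  simpa only [Polynomial.finsetSum_coeff, Polynomial.coeff_monomial, Finset.sum_ite_eq',
    Finset.mem_range, hk, if_true, Polynomial.coeff_zero] using h3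

end Comparison

/-! ### The Capelli polynomial -/

theorem natDegree_det_le_sum {R n : Type*} [CommRing R] [Fintype n] [DecidableEq n]
    (A : Matrix n n (Polynomial R)) (d : n → ℕ) (h : ∀ i j, (A i j).natDegree ≤ d i) :
    A.det.natDegree ≤ ∑ i, d i := by
  rw [Matrix.det_apply']
  refine Polynomial.natDegree_sum_le_of_forall_le _ _ fun σ _ => ?_
  refine Polynomial.natDegree_mul_le.trans ?_
  rw [Polynomial.natDegree_intCast, zero_add, ← Equiv.sum_comp σ d]
  exact (Polynomial.natDegree_prod_le _ _).trans (Finset.sum_le_sum fun i _ => h _ _)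

theorem coeff_coeff_swap {R : Type*} [CommRing R] (p : Polynomial (Polynomial R)) (a b : ℕ) :
    ((Polynomial.Bivariate.swap p).coeff a).coeff b = (p.coeff b).coeff a := by
  induction p using Polynomial.induction_on' with
  | add p q hp hq => simp only [map_add, Polynomial.coeff_add, hp, hq]
  | monomial n f =>
    induction f using Polynomial.induction_on' with
    | add p q hp hq => simp only [map_add, Polynomial.coeff_add, hp, hq]
    | monomial m r =>
      rw [Polynomial.Bivariate.swap_monomial_monomial]
      simp only [Polynomial.coeff_monomial]
      split_ifs <;> simp_all [Polynomial.coeff_monomial]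

section CapelliPolynomial

variable {K : Type*} [Field K] {M N : ℕ} {R : Type*} [CommRing R] [Algebra K R]
    (x y : Fin M → Fin N → R)

/-- The matrix with blocks `u - z`, `x`, `y`, `p - lam`. -/
def capelliMatrix (z : Fin N → K) (lam : Fin M → K) :
    Matrix (Fin N ⊕ Fin M) (Fin N ⊕ Fin M) (Polynomial (Polynomial R)) :=
  Matrix.fromBlocks
    (Matrix.diagonal fun a =>
      Polynomial.C (Polynomial.X - Polynomial.C (algebraMap K _ (z a))))
    (Matrix.of fun a j => Polynomial.C (Polynomial.C (x j a)))
    (Matrix.of fun i a => Polynomial.C (Polynomial.C (y i a)))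
    (Matrix.diagonal fun i =>
      Polynomial.X - Polynomial.C (Polynomial.C (algebraMap K _ (lam i))))

/-- The determinant of `capelliMatrix`, a polynomial in `u` (the inner variable) and `p` (the
outer variable). -/
def capelliPoly (z : Fin N → K) (lam : Fin M → K) : Polynomial (Polynomial R) :=
  (capelliMatrix x y z lam).det

/-- This is the duality at the level of symbols: exchanging the two blocks, transposing, and
interchanging `u` with `p` carries one block matrix to the other, and none of this changes the
determinant beyond the renaming of variables. -/
theorem swap_capelliPoly (z : Fin N → K) (lam : Fin M → K) :
    Polynomial.Bivariate.swap (capelliPoly (fun a i => x i a) (fun a i => y i a) lam z)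
      = capelliPoly x y z lam := by
  refine (RingHom.map_det (RingHomClass.toRingHom (Polynomial.Bivariate.swap (R := R)))
    (capelliMatrix (fun a i => x i a) (fun a i => y i a) lam z)).trans ?_
  rw [capelliPoly, ← Matrix.det_transpose (capelliMatrix x y z lam),
    ← Matrix.det_reindex_self (Equiv.sumComm (Fin N) (Fin M))]
  congr 1
  ext1 i j
  rcases i with i | i <;> rcases j with j | j
  · rcases eq_or_ne i j with rfl | h
    · simp [capelliMatrix, Polynomial.Bivariate.swap_apply]
    · simp [capelliMatrix, h, h.symm]
  · simp [capelliMatrix, Polynomial.Bivariate.swap_apply]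
  · simp [capelliMatrix, Polynomial.Bivariate.swap_apply]
  · rcases eq_or_ne i j with rfl | h
    · simp [capelliMatrix, Polynomial.Bivariate.swap_apply]
    · simp [capelliMatrix, h, h.symm]

theorem coeff_capelliPoly_transpose (z : Fin N → K) (lam : Fin M → K) (a b : ℕ) :
    ((capelliPoly (fun a i => x i a) (fun a i => y i a) lam z).coeff a).coeff b
      = ((capelliPoly x y z lam).coeff b).coeff a := by
  rw [← swap_capelliPoly, coeff_coeff_swap]

/-- The variable `p` occurs only in the `M` rows of the second block, and at most linearly there. -/
theorem natDegree_capelliPoly (z : Fin N → K) (lam : Fin M → K) :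
    (capelliPoly x y z lam).natDegree ≤ M := by
  refine (natDegree_det_le_sum _ (Sum.elim (fun _ => 0) (fun _ => 1)) ?_).trans (by simp)
  rintro (i | i) (j | j)
  · simp only [capelliMatrix, Matrix.fromBlocks_apply₁₁, Matrix.diagonal_apply, Sum.elim_inl]
    split_ifs <;> simp
  · simp [capelliMatrix]
  · simp [capelliMatrix]
  · simp only [capelliMatrix, Matrix.fromBlocks_apply₂₂, Matrix.diagonal_apply, Sum.elim_inr]
    split_ifs
    · exact (Polynomial.natDegree_X_sub_C_le _)
    · simp

/-- The bound on the degree in `u` is the bound on the degree in `p` for the transposed data. -/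
theorem natDegree_coeff_capelliPoly (z : Fin N → K) (lam : Fin M → K) (k : ℕ) :
    ((capelliPoly x y z lam).coeff k).natDegree ≤ N := by
  refine Polynomial.natDegree_le_iff_coeff_eq_zero.mpr fun a ha => ?_
  rw [← coeff_capelliPoly_transpose, Polynomial.coeff_eq_zero_of_natDegree_lt
    ((natDegree_capelliPoly _ _ _ _).trans_lt ha), Polynomial.coeff_zero]

/-- The symbol of an entry of the Gaudin matrix, at `p = c`. -/
def gaudinSymbol (z : Fin N → K) (lam : Fin M → K) (c : K) :
    Matrix (Fin M) (Fin M) (RatFunc K ⊗[K] R) :=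
  fun i j => (if i = j then algebraMap K _ (c - lam i) else 0)
    - ∑ a, (RatFunc.X - RatFunc.C (z a))⁻¹ ⊗ₜ[K] (x j a * y i a)

/-- Evaluation of a polynomial in `u` and `p` at `p = c`, as a rational function of `u`. -/
def evalSymbol (c : K) : Polynomial (Polynomial R) →+* RatFunc K ⊗[K] R :=
  Polynomial.eval₂RingHom
    (Polynomial.eval₂RingHom
      (Algebra.TensorProduct.includeRight : R →ₐ[K] RatFunc K ⊗[K] R).toRingHom
      (RatFunc.X ⊗ₜ 1))
    (algebraMap K _ c)

theorem evalSymbol_C_C (c : K) (s : R) :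
    evalSymbol c (Polynomial.C (Polynomial.C s)) = (1 : RatFunc K) ⊗ₜ[K] s := by
  simp [evalSymbol]

theorem evalSymbol_C_X (c : K) :
    evalSymbol (R := R) c (Polynomial.C Polynomial.X) = RatFunc.X ⊗ₜ[K] 1 := by
  simp [evalSymbol]

theorem evalSymbol_X (c : K) :
    evalSymbol (R := R) c Polynomial.X = algebraMap K _ c := by
  simp [evalSymbol]

theorem algebraMap_eq_one_tmul (r : K) :
    algebraMap K (RatFunc K ⊗[K] R) r = (1 : RatFunc K) ⊗ₜ[K] algebraMap K R r := by
  rw [Algebra.TensorProduct.algebraMap_apply, Algebra.algebraMap_eq_smul_one,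
    Algebra.algebraMap_eq_smul_one, TensorProduct.smul_tmul]

/-- Over rational functions of `u` the block `u - z` is invertible, with determinant `∏ a, (u - z
a)`, and its Schur complement is `gaudinSymbol`. -/
theorem evalSymbol_capelliPoly (z : Fin N → K) (lam : Fin M → K) (c : K) :
    evalSymbol c (capelliPoly x y z lam)
      = (∏ a, (RatFunc.X - RatFunc.C (z a))) • (gaudinSymbol x y z lam c).det := by
  have hC : ∀ r : K, (RatFunc.C r : RatFunc K) ⊗ₜ[K] (1 : R)
      = 1 ⊗ₜ[K] algebraMap K R r := by
    intro r
    rw [Algebra.algebraMap_eq_smul_one, TensorProduct.tmul_smul, TensorProduct.smul_tmul',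
      RatFunc.smul_eq_C_mul, mul_one]
  let A : Matrix (Fin N) (Fin N) (RatFunc K ⊗[K] R) :=
    Matrix.diagonal fun a => (RatFunc.X - RatFunc.C (z a)) ⊗ₜ[K] 1
  let A' : Matrix (Fin N) (Fin N) (RatFunc K ⊗[K] R) :=
    Matrix.diagonal fun a => (RatFunc.X - RatFunc.C (z a))⁻¹ ⊗ₜ[K] 1
  have hA'A : A' * A = 1 := by
    rw [Matrix.diagonal_mul_diagonal, ← Matrix.diagonal_one]
    congr 1
    ext1 a
    rw [Algebra.TensorProduct.tmul_mul_tmul, inv_mul_cancel₀ (X_sub_C_ne_zero _), one_mul]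
    rfl
  have hAA' : A * A' = 1 := by
    rw [Matrix.diagonal_mul_diagonal, ← Matrix.diagonal_one]
    congr 1
    ext1 a
    rw [Algebra.TensorProduct.tmul_mul_tmul, mul_inv_cancel₀ (X_sub_C_ne_zero _), one_mul]
    rfl
  let _ : Invertible A := ⟨A', hA'A, hAA'⟩
  have hmat : (evalSymbol c).mapMatrix (capelliMatrix x y z lam) = Matrix.fromBlocks A
      (Matrix.of fun a j => 1 ⊗ₜ[K] x j a) (Matrix.of fun i a => 1 ⊗ₜ[K] y i a)
      (Matrix.diagonal fun i => algebraMap K _ (c - lam i)) := by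
    ext1 i j
    rcases i with i | i <;> rcases j with j | j
    · simp only [capelliMatrix, RingHom.mapMatrix_apply, Matrix.map_apply,
        Matrix.fromBlocks_apply₁₁, Matrix.diagonal_apply, A]
      split_ifs
      · rw [map_sub, map_sub, evalSymbol_C_C, evalSymbol_C_X, TensorProduct.sub_tmul, hC]
      · exact map_zero _
    · simp [capelliMatrix, evalSymbol_C_C]
    · simp [capelliMatrix, evalSymbol_C_C]
    · simp only [capelliMatrix, RingHom.mapMatrix_apply, Matrix.map_apply,
        Matrix.fromBlocks_apply₂₂, Matrix.diagonal_apply]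
      split_ifs
      · rw [map_sub, map_sub, evalSymbol_C_C, evalSymbol_X, ← algebraMap_eq_one_tmul]
      · exact map_zero _
  have hdet : A.det = (∏ a, (RatFunc.X - RatFunc.C (z a))) ⊗ₜ[K] 1 := by
    rw [Matrix.det_diagonal]
    exact (map_prod (Algebra.TensorProduct.includeLeft : RatFunc K →ₐ[K] RatFunc K ⊗[K] R) _ _).symm
  rw [capelliPoly, RingHom.map_det, hmat, Matrix.det_fromBlocks₁₁, hdet, Algebra.smul_def]
  congr 2
  ext1 i j
  rw [Matrix.sub_apply, Matrix.mul_apply, gaudinSymbol, Matrix.diagonal_apply]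
  congr 1
  refine Finset.sum_congr rfl fun a _ => ?_
  change ((Matrix.of fun i a => (1 : RatFunc K) ⊗ₜ[K] y i a) * A') i a * _ = _
  rw [Matrix.mul_diagonal, Matrix.of_apply, Matrix.of_apply, Algebra.TensorProduct.tmul_mul_tmul,
    Algebra.TensorProduct.tmul_mul_tmul, mul_one, one_mul, mul_one,
    mul_comm (y i a)]

theorem evalSymbol_capelliPoly_eq_sum (z : Fin N → K) (lam : Fin M → K) (c : K) :
    evalSymbol c (capelliPoly x y z lam)
      = ∑ b ∈ Finset.range (M + 1), c ^ b • ∑ a ∈ Finset.range (N + 1),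
          (RatFunc.X ^ a : RatFunc K) ⊗ₜ[K] ((capelliPoly x y z lam).coeff b).coeff a := by
  rw [evalSymbol, Polynomial.coe_eval₂RingHom, Polynomial.eval₂_eq_sum_range'
    _ (Nat.lt_succ_of_le (natDegree_capelliPoly x y z lam))]
  refine Finset.sum_congr rfl fun b _ => ?_
  rw [Polynomial.coe_eval₂RingHom, Polynomial.eval₂_eq_sum_range'
    _ (Nat.lt_succ_of_le (natDegree_coeff_capelliPoly x y z lam b)), ← map_pow, mul_comm,
    ← Algebra.smul_def]
  congr 1
  refine Finset.sum_congr rfl fun a _ => ?_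
  change (1 ⊗ₜ[K] _) * _ = _
  rw [Algebra.TensorProduct.tmul_pow, Algebra.TensorProduct.tmul_mul_tmul, one_mul, one_pow,
    mul_one]

end CapelliPolynomial

/-! ### Symbols of the entries of the Gaudin matrix -/

/-- Operators `x i a`, `D i a` on a commutative algebra `V`, where `D i a` behaves as the partial
derivative with respect to `x i a`, with commuting symbols `y i a ∈ Y` of the `D i a`. -/
structure Polarization (K : Type*) [Field K] (M N : ℕ) (V Y : Type*) [CommRing V] [Algebra K V]
    [CommRing Y] [Algebra K Y] where
  quantize : Y →ₐ[K] Module.End K V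
  x : Fin M → Fin N → V
  y : Fin M → Fin N → Y
  D : Fin M → Fin N → Derivation K V V
  quantize_y : ∀ i a, quantize (y i a) = (D i a : V →ₗ[K] V)
  D_x : ∀ i a j b, D i a (x j b) = if i = j ∧ a = b then 1 else 0

namespace Polarization

variable {K : Type*} [Field K] {M N : ℕ} {V Y : Type*} [CommRing V] [Algebra K V]
    [CommRing Y] [Algebra K Y] (P : Polarization K M N V Y)

/-- The same operators with the two indices interchanged. -/
def transpose : Polarization K N M V Y where
  quantize := P.quantize
  x a i := P.x i a
  y a i := P.y i a
  D a i := P.D i a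
  quantize_y a i := P.quantize_y i a
  D_x a i b j := by simp only [P.D_x, and_comm]

/-- The symbol of multiplication by `x i a`. -/
def symX (i : Fin M) (a : Fin N) : V ⊗[K] Y := P.x i a ⊗ₜ 1

/-- The symbol of `D i a`. -/
def symY (i : Fin M) (a : Fin N) : V ⊗[K] Y := 1 ⊗ₜ P.y i a

/-- The first order part of the action of an entry of the Gaudin matrix on symbols. -/
def gaudinDeriv (z : Fin N → K) (i j : Fin M) :
    Derivation K (RatFunc K ⊗[K] (V ⊗[K] Y)) (RatFunc K ⊗[K] (V ⊗[K] Y)) :=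
  (if i = j then derivLeft (V ⊗[K] Y) (ratDeriv K) else 0)
    - ∑ a, ((RatFunc.X - RatFunc.C (z a))⁻¹ ⊗ₜ[K] (P.x j a ⊗ₜ[K] (1 : Y))) •
        derivRight (RatFunc K) (derivLeft Y (P.D i a))

theorem ratDeriv_inv (c : K) : ratDeriv K (RatFunc.X - RatFunc.C c)⁻¹
    = -((RatFunc.X - RatFunc.C c)⁻¹ ^ 2) := by
  have h : ratDeriv K (RatFunc.X - RatFunc.C c) = 1 := by
    rw [← RatFunc.algebraMap_X, ← RatFunc.algebraMap_C, ← map_sub, ratDeriv_algebraMap]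
    simp
  rw [Derivation.leibniz_inv, h, smul_eq_mul, mul_one]

/-- Two contractions contribute: `d/du` on the pole `(u - z a)⁻¹`, and `D i a` on the factor `x l
a`. Contractions between different points vanish. The result is visibly symmetric in `j` and `l`, as
the cancellation requires. -/
theorem gaudinDeriv_gaudinSymbol (z : Fin N → K) (lam : Fin M → K) (c : K) (i j k l : Fin M) :
    P.gaudinDeriv z i j (gaudinSymbol P.symX P.symY z lam c k l)
      = ∑ a, ((RatFunc.X - RatFunc.C (z a))⁻¹ ^ 2) ⊗ₜ[K]
          (((if i = j then P.x l a else 0) + (if i = l then P.x j a else 0)) ⊗ₜ[K] P.y k a) := by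
  have hconst : P.gaudinDeriv z i j
      ((if k = l then algebraMap K _ (c - lam k) else 0 : RatFunc K ⊗[K] (V ⊗[K] Y))) = 0 := by
    split_ifs
    · exact Derivation.map_algebraMap _ _
    · exact map_zero _
  simp only [gaudinSymbol, symX, symY, Algebra.TensorProduct.tmul_mul_tmul, mul_one, one_mul]
  rw [map_sub, hconst, zero_sub, map_sum, ← Finset.sum_neg_distrib]
  refine Finset.sum_congr rfl fun a _ => ?_
  rw [gaudinDeriv, Derivation.sub_apply, derivation_sum_apply, Finset.sum_eq_single a]
  · rw [Derivation.smul_apply, derivRight_tmul, derivLeft_tmul, P.D_x, TensorProduct.add_tmul,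
      TensorProduct.tmul_add, neg_sub, sub_eq_neg_add]
    congr 1
    · split_ifs
      · rw [derivLeft_tmul, ratDeriv_inv, TensorProduct.neg_tmul, neg_neg]
      · simp
    · simp only [smul_eq_mul, Algebra.TensorProduct.tmul_mul_tmul, one_mul, and_true, mul_ite,
        mul_one, mul_zero, sq]
  · intro b _ hb
    rw [Derivation.smul_apply, derivRight_tmul, derivLeft_tmul, P.D_x, if_neg (fun h => hb h.2)]
    simp
  · simp

theorem rdet_gaudin (z : Fin N → K) (lam : Fin M → K) (c : K) :
    rdet (firstOrder (gaudinSymbol P.symX P.symY z lam c) (P.gaudinDeriv z)) 1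
      = (gaudinSymbol P.symX P.symY z lam c).det := by
  refine rdet_firstOrder_one _ _ fun i j k l _ => ?_
  rw [gaudinDeriv_gaudinSymbol, gaudinDeriv_gaudinSymbol]
  simp only [add_comm]

end Polarization

/-! ### The action of differential operators on a vector -/

section SymbolAt

variable {K : Type*} [Field K] {V A : Type*} [CommRing V] [Algebra K V] [Ring A] [Algebra K A]
    (ρ : A →ₐ[K] Module.End K V) (w : V)

/-- The action on `w` of a rational function of `u` with values in `A`. -/
def actCoeff : RatFunc K ⊗[K] A →ₗ[RatFunc K] RatFunc K ⊗[K] V :=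
  (ρ.toLinearMap.flip w).baseChange (RatFunc K)

theorem actCoeff_tmul (f : RatFunc K) (a : A) : actCoeff ρ w (f ⊗ₜ a) = f ⊗ₜ ρ a w := rfl

/-- The result of `D` acting on `w`, where `∂ ^ k` is replaced by `c ^ k`. -/
def symbolAt (c : K) : DiffOp K A →+ RatFunc K ⊗[K] V :=
  Finsupp.liftAddHom (M := RatFunc K ⊗[K] A) (N := RatFunc K ⊗[K] V) fun k =>
    (c ^ k • actCoeff ρ w).toAddMonoidHom

theorem symbolAt_monomial (c : K) (k : ℕ) (b : RatFunc K ⊗[K] A) :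
    symbolAt ρ w c (monomial _ k b) = c ^ k • actCoeff ρ w b :=
  Finsupp.liftAddHom_apply_single (M := RatFunc K ⊗[K] A) (N := RatFunc K ⊗[K] V) _ k b

theorem symbolAt_one (c : K) : symbolAt ρ w c 1 = 1 ⊗ₜ w := by
  change symbolAt ρ w c (monomial _ 0 1) = _
  rw [symbolAt_monomial, pow_zero, one_smul, Algebra.TensorProduct.one_def, actCoeff_tmul, map_one]
  rfl

theorem symbolAt_eq_sum (c : K) (n : ℕ) (D : DiffOp K A) (hD : ∀ k, n < k → D.coeff k = 0) :
    symbolAt ρ w c D = ∑ k ∈ Finset.range (n + 1), c ^ k • actCoeff ρ w (D.coeff k) := by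
  have h : D = ∑ k ∈ Finset.range (n + 1), monomial _ k (D.coeff k) := by
    refine ext_coeff _ fun k => ?_
    simp only [coeff_sum, coeff_monomial, Finset.sum_ite_eq', Finset.mem_range]
    split_ifs with hk
    · rfl
    · exact hD k (by omega)
  conv_lhs => rw [h]
  rw [map_sum]
  simp only [symbolAt_monomial]

theorem actCoeff_tensorDeriv (b : RatFunc K ⊗[K] A) :
    actCoeff ρ w ((tensorDeriv K A).toAddMonoidHom b)
      = (ratDeriv K : RatFunc K →ₗ[K] RatFunc K).rTensor V (actCoeff ρ w b) := by
  induction b using TensorProduct.induction_on with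
  | zero => simp
  | add x y hx hy => simp only [map_add, hx, hy]
  | tmul f a => rfl

theorem actCoeff_mul (f : RatFunc K) (a : A) (b : RatFunc K ⊗[K] A) :
    actCoeff ρ w (f ⊗ₜ a * b)
      = TensorProduct.map (LinearMap.mulLeft K f) (ρ a) (actCoeff ρ w b) := by
  induction b using TensorProduct.induction_on with
  | zero => simp
  | add x y hx hy => simp only [mul_add, map_add, hx, hy]
  | tmul g b =>
    rw [Algebra.TensorProduct.tmul_mul_tmul, actCoeff_tmul, actCoeff_tmul, map_mul]
    rfl

/-- The relation `∂ * b = δ b + b * ∂` turns left multiplication by `∂` into `d/du + c`. The map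
`symbolAt` is not multiplicative, but left multiplication by `∂` and by operators of order zero can
be followed through it. -/
theorem symbolAt_del_mul (c : K) (D : DiffOp K A) :
    symbolAt ρ w c (del _ * D)
      = (ratDeriv K : RatFunc K →ₗ[K] RatFunc K).rTensor V (symbolAt ρ w c D)
        + c • symbolAt ρ w c D := by
  let L : RatFunc K ⊗[K] V →ₗ[K] RatFunc K ⊗[K] V :=
    (ratDeriv K : RatFunc K →ₗ[K] RatFunc K).rTensor V + c • LinearMap.id
  have h : (symbolAt ρ w c).comp (AddMonoidHom.mulLeft (del _))
      = L.toAddMonoidHom.comp (symbolAt ρ w c) :=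
    hom_ext _ fun k b => by
      change symbolAt ρ w c (del _ * monomial _ k b)
        = (ratDeriv K : RatFunc K →ₗ[K] RatFunc K).rTensor V (symbolAt ρ w c (monomial _ k b)) + c • symbolAt ρ w c (monomial _ k b)
      rw [del_mul_monomial, map_add, symbolAt_monomial, symbolAt_monomial, symbolAt_monomial,
        actCoeff_tensorDeriv, map_smul, pow_succ', mul_smul]
  exact DFunLike.congr_fun h D

theorem symbolAt_of_mul (c : K) (f : RatFunc K) (a : A) (D : DiffOp K A) :
    symbolAt ρ w c (of _ (f ⊗ₜ a) * D)
      = TensorProduct.map (LinearMap.mulLeft K f) (ρ a) (symbolAt ρ w c D) := by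
  have h : (symbolAt ρ w c).comp (AddMonoidHom.mulLeft (of _ (f ⊗ₜ a)))
      = (TensorProduct.map (LinearMap.mulLeft K f) (ρ a)).toAddMonoidHom.comp (symbolAt ρ w c) :=
    hom_ext _ fun k b => by
      change symbolAt ρ w c (of _ (f ⊗ₜ a) * monomial _ k b)
        = TensorProduct.map (LinearMap.mulLeft K f) (ρ a) (symbolAt ρ w c (monomial _ k b))
      rw [of_mul_monomial, symbolAt_monomial, symbolAt_monomial, actCoeff_mul, map_smul]
  exact DFunLike.congr_fun h D

theorem symbolAt_algebraMap_mul (c r : K) (D : DiffOp K A) :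
    symbolAt ρ w c (of _ (algebraMap K _ r) * D) = r • symbolAt ρ w c D := by
  rw [Algebra.TensorProduct.algebraMap_apply, symbolAt_of_mul, map_one]
  have h : TensorProduct.map (LinearMap.mulLeft K (algebraMap K (RatFunc K) r))
      (1 : Module.End K V) = r • LinearMap.id := by
    refine TensorProduct.ext' fun f v => ?_
    rw [TensorProduct.map_tmul, LinearMap.mulLeft_apply, ← Algebra.smul_def]
    rfl
  rw [h]
  rfl

end SymbolAt

/-! ### Normal ordering of symbols. -/

namespace Polarization

variable {K : Type*} [Field K] {M N : ℕ} {V Y : Type*} [CommRing V] [Algebra K V]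
    [CommRing Y] [Algebra K Y] (P : Polarization K M N V Y) (w : V)

/-- The action on `w` of the normally ordered operator with a given symbol. -/
def normalOrder : V ⊗[K] Y →ₗ[K] V :=
  TensorProduct.lift ((LinearMap.mul K V).compl₂ (P.quantize.toLinearMap.flip w))

theorem normalOrder_tmul (v : V) (q : Y) :
    P.normalOrder w (v ⊗ₜ q) = v * P.quantize q w := rfl

/-- Moving `D i a` to the right past a coefficient `v` gives, by the Leibniz rule, the product of
symbols and one contraction with `v`. The contraction is the derivation part of `gaudinDeriv`. -/
theorem normalOrder_mul (i j : Fin M) (a : Fin N) (s : V ⊗[K] Y) :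
    P.normalOrder w (P.symX j a * P.symY i a * s + P.symX j a * derivLeft Y (P.D i a) s)
      = P.x j a * P.D i a (P.normalOrder w s) := by
  induction s using TensorProduct.induction_on with
  | zero => simp
  | add s t hs ht =>
    rw [map_add (P.normalOrder w) s t, map_add (P.D i a), mul_add (P.x j a), ← hs, ← ht, mul_add,
      map_add (derivLeft _ _), mul_add, map_add, map_add, map_add, map_add, map_add]
    abel
  | tmul v q =>
    rw [symX, symY, derivLeft_tmul, map_add, Algebra.TensorProduct.tmul_mul_tmul,
      Algebra.TensorProduct.tmul_mul_tmul, Algebra.TensorProduct.tmul_mul_tmul, normalOrder_tmul,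
      normalOrder_tmul, normalOrder_tmul, Derivation.leibniz, one_mul, one_mul, mul_one, map_mul,
      P.quantize_y, Module.End.mul_apply, Derivation.coeFn_coe, smul_eq_mul, smul_eq_mul]
    ring

/-- `normalOrder` with rational functions as coefficients. -/
def ratNormalOrder : RatFunc K ⊗[K] (V ⊗[K] Y) →ₗ[RatFunc K] RatFunc K ⊗[K] V :=
  (P.normalOrder w).baseChange (RatFunc K)

theorem ratNormalOrder_tmul (f : RatFunc K) (s : V ⊗[K] Y) :
    P.ratNormalOrder w (f ⊗ₜ s) = f ⊗ₜ P.normalOrder w s := rfl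

theorem ratNormalOrder_deriv (s : RatFunc K ⊗[K] (V ⊗[K] Y)) :
    P.ratNormalOrder w (derivLeft (V ⊗[K] Y) (ratDeriv K) s)
      = (ratDeriv K : RatFunc K →ₗ[K] RatFunc K).rTensor V (P.ratNormalOrder w s) := by
  induction s using TensorProduct.induction_on with
  | zero => simp
  | add x y hx hy => simp only [map_add, hx, hy]
  | tmul f a => rfl

variable {A : Type*} [Ring A] [Algebra K A] (ρ : A →ₐ[K] Module.End K V)

theorem ratNormalOrder_mul (i j : Fin M) (a : Fin N) (f : RatFunc K) (e : A)
    (he : ∀ v, ρ e v = P.x j a * P.D i a v) (s : RatFunc K ⊗[K] (V ⊗[K] Y)) :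
    P.ratNormalOrder w (f ⊗ₜ[K] (P.symX j a * P.symY i a) * s
        + f ⊗ₜ[K] P.symX j a * derivRight (RatFunc K) (derivLeft Y (P.D i a)) s)
      = TensorProduct.map (LinearMap.mulLeft K f) (ρ e) (P.ratNormalOrder w s) := by
  induction s using TensorProduct.induction_on with
  | zero => simp
  | add s t hs ht =>
    rw [map_add (P.ratNormalOrder w) s t, map_add (TensorProduct.map _ _), ← hs, ← ht, mul_add,
      map_add (derivRight _ _), mul_add, map_add, map_add, map_add, map_add, map_add]
    abel
  | tmul g c =>
    rw [derivRight_tmul, Algebra.TensorProduct.tmul_mul_tmul,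
      Algebra.TensorProduct.tmul_mul_tmul, ← TensorProduct.tmul_add, ratNormalOrder_tmul,
      normalOrder_mul, ← he]
    rfl

end Polarization

/-! ### The row determinant as a normally ordered determinant. -/

namespace Polarization

variable {K : Type*} [Field K] {M N : ℕ} {V Y : Type*} [CommRing V] [Algebra K V]
    [CommRing Y] [Algebra K Y] (P : Polarization K M N V Y)
    (ρ : UGlTensor K M N →ₐ[K] Module.End K V)
    (z : Fin N → K) (lam : Fin M → K) (w : V) (c : K)

theorem symbolAt_gaudinMatrix_mul
    (hρ : ∀ a i j v, ρ (inFactor a (Matrix.single i j 1)) v = P.x i a * P.D j a v)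
    (i j : Fin M) (D : DiffOp K (UGlTensor K M N))
    (s : RatFunc K ⊗[K] (V ⊗[K] Y)) (hs : symbolAt ρ w c D = P.ratNormalOrder w s) :
    symbolAt ρ w c (gaudinMatrix K M N z lam i j * D)
      = P.ratNormalOrder w
        (firstOrder (gaudinSymbol P.symX P.symY z lam c) (P.gaudinDeriv z) i j s) := by
  -- The multiplication and derivation parts are regrouped point by point, so that each summand has
  -- the shape of `ratNormalOrder_mul`.
  have hsplit : firstOrder (gaudinSymbol P.symX P.symY z lam c) (P.gaudinDeriv z) i j s
      = (if i = j then (c - lam i) • s + derivLeft (V ⊗[K] Y) (ratDeriv K) s else 0)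
        - ∑ a, ((RatFunc.X - RatFunc.C (z a))⁻¹ ⊗ₜ[K] (P.symX j a * P.symY i a) * s
          + (RatFunc.X - RatFunc.C (z a))⁻¹ ⊗ₜ[K] P.symX j a *
            derivRight (RatFunc K) (derivLeft Y (P.D i a)) s) := by
    rw [firstOrder, LinearMap.add_apply, LinearMap.mulLeft_apply, Derivation.coeFn_coe,
      gaudinSymbol, gaudinDeriv, Derivation.sub_apply, derivation_sum_apply, sub_mul,
      Finset.sum_mul, Finset.sum_add_distrib]
    have h1 : (if i = j then algebraMap K (RatFunc K ⊗[K] (V ⊗[K] Y)) (c - lam i) else 0) * s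
        + (if i = j then derivLeft (V ⊗[K] Y) (ratDeriv K) else 0) s
        = if i = j then (c - lam i) • s + derivLeft (V ⊗[K] Y) (ratDeriv K) s else 0 := by
      split_ifs
      · congr 1
        exact (Algebra.smul_def _ _).symm
      · rw [zero_mul, zero_add]
        rfl
    rw [← h1]
    simp only [Derivation.smul_apply, smul_eq_mul, symX]
    abel
  rw [hsplit, map_sub, map_sum]
  simp only [ratNormalOrder_mul P w ρ i _ _ _ _ fun v => hρ _ _ _ v]
  rw [gaudinMatrix, sub_mul, Finset.sum_mul, map_sub, map_sum]
  simp only [symbolAt_of_mul, hs]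
  congr 1
  split_ifs
  · rw [sub_mul, map_sub, symbolAt_del_mul, symbolAt_algebraMap_mul, hs, map_add,
      ratNormalOrder_deriv, LinearMap.map_smul_of_tower, sub_smul]
    abel
  · rw [zero_mul, map_zero, map_zero]

theorem symbolAt_prod_ofFn {n : ℕ} (e : Fin n → DiffOp K (UGlTensor K M N))
    (o : Fin n → Module.End K (RatFunc K ⊗[K] (V ⊗[K] Y)))
    (h : ∀ i D s, symbolAt ρ w c D = P.ratNormalOrder w s →
      symbolAt ρ w c (e i * D) = P.ratNormalOrder w (o i s)) :
    symbolAt ρ w c (List.ofFn e).prod = P.ratNormalOrder w ((List.ofFn o).prod 1) := by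
  induction n with
  | zero =>
    rw [List.ofFn_zero, List.ofFn_zero, List.prod_nil, List.prod_nil, symbolAt_one,
      Module.End.one_apply, Algebra.TensorProduct.one_def, ratNormalOrder_tmul,
      Algebra.TensorProduct.one_def, normalOrder_tmul, map_one, one_mul]
    rfl
  | succ n ih =>
    rw [List.ofFn_succ, List.ofFn_succ, List.prod_cons, List.prod_cons, Module.End.mul_apply]
    exact h 0 _ _ (ih _ _ fun i => h i.succ)

/-- Each row product, applied to the symbol `1`, is followed entry by entry; then `rdet_gaudin`
removes all contractions from the alternating sum. -/
theorem symbolAt_gaudinOp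
    (hρ : ∀ a i j v, ρ (inFactor a (Matrix.single i j 1)) v = P.x i a * P.D j a v) :
    symbolAt ρ w c (gaudinOp K M N z lam)
    = P.ratNormalOrder w (gaudinSymbol P.symX P.symY z lam c).det := by
  rw [← P.rdet_gaudin, gaudinOp, rdet, rdet, map_sum, LinearMap.sum_apply, map_sum]
  refine Finset.sum_congr rfl fun σ _ => ?_
  rw [← zsmul_eq_mul, ← zsmul_eq_mul, map_zsmul, LinearMap.smul_apply, map_zsmul]
  congr 1
  exact P.symbolAt_prod_ofFn ρ w c _ _ fun i D s hs =>
    P.symbolAt_gaudinMatrix_mul ρ z lam w c hρ i (σ i) D s hs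

/-- The action of the coefficients of the row determinant, cleared of denominators, in terms of
the coefficients of the Capelli polynomial. -/
theorem actCoeff_gaudinOp [Infinite K]
    (hρ : ∀ a i j v, ρ (inFactor a (Matrix.single i j 1)) v = P.x i a * P.D j a v)
    {k : ℕ} (hk : k ≤ M) :
    (∏ a, (RatFunc.X - RatFunc.C (z a)) : RatFunc K) •
        actCoeff ρ w ((gaudinOp K M N z lam).coeff k)
      = ∑ a ∈ Finset.range (N + 1), (RatFunc.X ^ a : RatFunc K) ⊗ₜ[K]
          P.normalOrder w (((capelliPoly P.symX P.symY z lam).coeff k).coeff a) := by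
  -- Both sides are the coefficients of `c ^ k` in an identity valid for every scalar `c`.
  refine eq_of_sum_pow_smul (K := K) (n := M + 1)
    (v := fun k => (∏ a, (RatFunc.X - RatFunc.C (z a)) : RatFunc K) •
        actCoeff ρ w ((gaudinOp K M N z lam).coeff k))
    (v' := fun k => ∑ a ∈ Finset.range (N + 1), (RatFunc.X ^ a : RatFunc K) ⊗ₜ[K]
          P.normalOrder w (((capelliPoly P.symX P.symY z lam).coeff k).coeff a))
    (fun c => ?_) (Nat.lt_succ_of_le hk)
  have h1 := congrArg (P.ratNormalOrder w) (evalSymbol_capelliPoly P.symX P.symY z lam c)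
  rw [map_smul, ← P.symbolAt_gaudinOp ρ z lam w c hρ, symbolAt_eq_sum ρ w c M _
    (gaudinOp_poleBound z lam).1, evalSymbol_capelliPoly_eq_sum, map_sum, Finset.smul_sum] at h1
  refine Eq.trans (Finset.sum_congr rfl fun k _ => smul_comm _ _ _) (h1.symm.trans ?_)
  refine Finset.sum_congr rfl fun k _ => ?_
  rw [LinearMap.map_smul_of_tower, map_sum]
  rfl

end Polarization

end DifferentialOperators

/-! ### Partial derivatives of polynomials in the variables `x i a` -/

section Polynomials

open MvPolynomial

/-- The commutator of two derivations is a derivation, and this one kills every variable. -/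
theorem pderiv_pderiv_comm {R σ : Type*} [CommRing R] (i j : σ) (p : MvPolynomial σ R) :
    pderiv i (pderiv j p) = pderiv j (pderiv i p) := by
  have h : ⁅pderiv (R := R) i, pderiv j⁆ =
      (0 : Derivation R (MvPolynomial σ R) (MvPolynomial σ R)) := by
    classical
    refine derivation_ext fun k => ?_
    rw [Derivation.commutator_apply, pderiv_X, pderiv_X, Pi.single_apply, Pi.single_apply]
    split_ifs <;> simp
  have h1 := DFunLike.congr_fun h p
  rwa [Derivation.commutator_apply, Derivation.zero_apply, sub_eq_zero] at h1

open scoped IsMulCommutative in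
/-- Polynomials in the partial derivatives, as operators on polynomials. -/
def derivQuantize (R σ : Type*) [CommRing R] :
    MvPolynomial σ R →ₐ[R] Module.End R (MvPolynomial σ R) :=
  let s : Set (Module.End R (MvPolynomial σ R)) := Set.range fun i => (pderiv i).toLinearMap
  -- Evaluating polynomials needs a commutative target, so the map goes through the subalgebra
  -- generated by the partial derivatives.
  have : IsMulCommutative (Algebra.adjoin R s) := Algebra.isMulCommutative_adjoin R (by
    rintro _ ⟨i, rfl⟩ _ ⟨j, rfl⟩
    exact LinearMap.ext fun p => pderiv_pderiv_comm i j p)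
  (Algebra.adjoin R s).val.comp
    (aeval fun i => (⟨(pderiv i).toLinearMap, Algebra.subset_adjoin ⟨i, rfl⟩⟩ : Algebra.adjoin R s))

theorem derivQuantize_X {R σ : Type*} [CommRing R] (i : σ) :
    derivQuantize R σ (X i) = (pderiv i).toLinearMap := by
  simp [derivQuantize]

variable (K : Type*) [Field K] (M N : ℕ)

/-- The polynomials in the `x i a` with their partial derivatives. -/
def polyPolarization :
    Polarization K M N (MvPolynomial (Fin M × Fin N) K) (MvPolynomial (Fin M × Fin N) K) where
  quantize := derivQuantize K _
  x i a := X (i, a)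
  y i a := X (i, a)
  D i a := pderiv (i, a)
  quantize_y i a := derivQuantize_X _
  D_x i a j b := by
    rw [pderiv_X, Pi.single_apply]
    simp only [Prod.mk.injEq, eq_comm]

variable {K M N}

theorem polyIso_tprod (f : Fin N → MvPolynomial (Fin M) K) :
    polyIso K M N (PiTensorProduct.tprod K f) = ∏ b, rename (fun i => (i, b)) (f b) := by
  change polyHom K M N (PiTensorProduct.tprod K f) = _
  exact PiTensorProduct.lift.tprod _

theorem tensorAction_inFactor_tprod (a : Fin N) (A : Matrix (Fin M) (Fin M) K)
    (f : Fin N → MvPolynomial (Fin M) K) :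
    tensorAction K M N (inFactor a A) (PiTensorProduct.tprod K f)
      = PiTensorProduct.tprod K (Function.update f a (glDerivation K M A (f a))) := by
  have h : tensorAction K M N (inFactor a A) = PiTensorProduct.map fun b =>
      UniversalEnvelopingAlgebra.lift K (glRep K M)
        ((Pi.mulSingle a (UniversalEnvelopingAlgebra.ι K A) : Fin N → UGl K M) b) :=
    PiTensorProduct.lift.tprod _
  rw [h, PiTensorProduct.map_tprod]
  congr 1
  ext1 b
  rcases eq_or_ne b a with rfl | hb
  · rw [Pi.mulSingle_eq_same, Function.update_self, UniversalEnvelopingAlgebra.lift_ι_apply]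
    rfl
  · rw [Pi.mulSingle_eq_of_ne hb, Function.update_of_ne hb, map_one]
    rfl

/-- The derivation by which `A ∈ gl_M` in the `a`-th factor acts on polynomials in the `x i a`. -/
def factorDerivation (a : Fin N) (A : Matrix (Fin M) (Fin M) K) :
    Derivation K (MvPolynomial (Fin M × Fin N) K) (MvPolynomial (Fin M × Fin N) K) :=
  ∑ i, ∑ j, A i j • (X (i, a) : MvPolynomial (Fin M × Fin N) K) • pderiv (j, a)

theorem factorDerivation_apply (a : Fin N) (A : Matrix (Fin M) (Fin M) K)
    (p : MvPolynomial (Fin M × Fin N) K) :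
    factorDerivation a A p = ∑ i, ∑ j, A i j • (X (i, a) * pderiv (j, a) p) := by
  simp [factorDerivation, derivation_sum_apply]

theorem factorDerivation_rename (a b : Fin N) (A : Matrix (Fin M) (Fin M) K)
    (f : MvPolynomial (Fin M) K) :
    factorDerivation a A (rename (fun i => (i, b)) f)
      = if b = a then rename (fun i => (i, b)) (glDerivation K M A f) else 0 := by
  rw [factorDerivation_apply]
  split_ifs with h
  · subst h
    have hgl : glDerivation K M A f = ∑ i, ∑ j, A i j • (X i * pderiv j f) := by
      simp [glDerivation, derivation_sum_apply]
    simp only [hgl, map_sum, map_smul, map_mul, rename_X]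
    refine Finset.sum_congr rfl fun i _ => Finset.sum_congr rfl fun j _ => ?_
    congr 2
    exact pderiv_rename (f := fun i : Fin M => (i, b)) (fun _ _ h => congrArg Prod.fst h) j f
  · refine Finset.sum_eq_zero fun i _ => Finset.sum_eq_zero fun j _ => ?_
    have hz : pderiv (j, a) (rename (fun i => (i, b)) f) = 0 := by
      refine pderiv_eq_zero_of_notMem_vars fun hmem => ?_
      have h1 := vars_rename _ _ hmem
      simp only [Finset.mem_image, Prod.mk.injEq] at h1
      obtain ⟨_, _, _, h2⟩ := h1
      exact h h2
    rw [hz, mul_zero, smul_zero]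

/-- On a pure tensor the Leibniz rule gives one term for each factor, and only the factor in the
variables `x i a` survives. -/
theorem polyIso_tensorAction_inFactor (a : Fin N) (A : Matrix (Fin M) (Fin M) K)
    (w : PolyTensor K M N) :
    polyIso K M N (tensorAction K M N (inFactor a A) w)
      = factorDerivation a A (polyIso K M N w) := by
  induction w using PiTensorProduct.induction_on with
  | add v w hv hw => simp only [map_add, hv, hw]
  | smul_tprod r f =>
    rw [map_smul, map_smul, map_smul, Derivation.map_smul, tensorAction_inFactor_tprod,
      polyIso_tprod, polyIso_tprod, derivation_prod, Finset.sum_eq_single a]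
    · rw [factorDerivation_rename, if_pos rfl, ← Finset.prod_erase_mul _ _ (Finset.mem_univ a),
        Function.update_self]
      congr 2
      refine Finset.prod_congr rfl fun b hb => ?_
      rw [Function.update_of_ne (Finset.ne_of_mem_erase hb)]
    · intro b _ hb
      rw [factorDerivation_rename, if_neg hb, mul_zero]
    · simp

theorem polyIso_tensorAction_single (a : Fin N) (i j : Fin M) (w : PolyTensor K M N) :
    polyIso K M N (tensorAction K M N (inFactor a (Matrix.single i j 1)) w)
      = X (i, a) * pderiv (j, a) (polyIso K M N w) := by
  rw [polyIso_tensorAction_inFactor, factorDerivation_apply, Finset.sum_eq_single i,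
    Finset.sum_eq_single j]
  · rw [Matrix.single_apply_same, one_smul]
  · intro l _ hl
    rw [Matrix.single_apply_of_ne _ _ _ _ _ (fun h => hl h.2.symm), zero_smul]
  · simp
  · intro k _ hk
    refine Finset.sum_eq_zero fun l _ => ?_
    rw [Matrix.single_apply_of_ne _ _ _ _ _ (fun h => hk h.1.symm), zero_smul]
  · simp

/-! ### Weight spaces -/

theorem coeff_X_mul_pderiv {σ R : Type*} [CommRing R] (i : σ) (s : σ →₀ ℕ)
    (p : MvPolynomial σ R) : coeff s (X i * pderiv i p) = (s i : R) * coeff s p := by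
  classical
  induction p using MvPolynomial.induction_on' with
  | monomial t r =>
    rw [X_mul_pderiv_monomial, coeff_smul, coeff_monomial, nsmul_eq_mul]
    split_ifs with h
    · rw [h]
    · simp
  | add p q hp hq => rw [map_add, mul_add, coeff_add, coeff_add, mul_add, hp, hq]

theorem coeff_tensorAction_diagonal (h : Fin M → K) (w : PolyTensor K M N)
    (s : Fin M × Fin N →₀ ℕ) :
    coeff s (polyIso K M N (tensorAction K M N (∑ a : Fin N, inFactor a (Matrix.diagonal h)) w))
      = (∑ i, ((∑ a, s (i, a) : ℕ) : K) * h i) * coeff s (polyIso K M N w) := by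
  rw [map_sum, LinearMap.sum_apply, map_sum, coeff_sum, Finset.sum_mul]
  simp only [Nat.cast_sum, Finset.sum_mul]
  rw [Finset.sum_comm]
  refine Finset.sum_congr rfl fun a _ => ?_
  rw [polyIso_tensorAction_inFactor, factorDerivation_apply, coeff_sum]
  refine Finset.sum_congr rfl fun i _ => ?_
  rw [coeff_sum, Finset.sum_eq_single i]
  · rw [Matrix.diagonal_apply_eq, coeff_smul, coeff_X_mul_pderiv, smul_eq_mul]
    ring
  · intro j _ hj
    rw [Matrix.diagonal_apply_ne' _ hj, zero_smul, coeff_zero]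
  · simp

/-- The weight of the variable `x i b` with respect to the degree in the variables `x 1 a`, …,
`x M a`. -/
def columnWeight (a : Fin N) (ib : Fin M × Fin N) : ℕ := if ib.2 = a then 1 else 0

theorem weight_columnWeight (a : Fin N) (s : Fin M × Fin N →₀ ℕ) :
    Finsupp.weight (columnWeight a) s = ∑ i, s (i, a) := by
  rw [Finsupp.weight_eq_sum, Fintype.sum_prod_type]
  simp [columnWeight]

theorem rename_isWeightedHomogeneous (a b : Fin N) {f : MvPolynomial (Fin M) K} {d : ℕ}
    (hf : f.IsHomogeneous d) :
    IsWeightedHomogeneous (columnWeight a) (rename (fun i => (i, b)) f)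
      (if b = a then d else 0) := by
  rw [← support_sum_monomial_coeff f, map_sum]
  refine IsWeightedHomogeneous.sum _ _ _ fun s hs => ?_
  rw [rename_monomial]
  refine isWeightedHomogeneous_monomial _ _ _ ?_
  have hd : ∑ i, s i = d := by
    have h1 := hf (mem_support_iff.mp hs)
    rwa [Finsupp.weight_eq_sum, Finset.sum_congr rfl fun i _ => by
      rw [Pi.one_apply, smul_eq_mul, mul_one]] at h1
  have hmap : Finsupp.weight (columnWeight a) (Finsupp.mapDomain (fun i : Fin M => (i, b)) s)
      = ∑ i, s i • columnWeight a (i, b) := by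
    rw [Finsupp.weight_apply, Finsupp.sum_mapDomain_index (by simp) (by simp [add_mul]),
      Finsupp.sum_fintype _ _ (by simp)]
  rw [hmap, ← hd]
  split_ifs with h <;> simp [columnWeight, h]

theorem mem_homTensor_iff (n : Fin N → ℕ) (w : PolyTensor K M N) :
    w ∈ homTensor K M N n ↔
      ∀ s ∈ (polyIso K M N w).support, ∀ a, ∑ i, s (i, a) = n a := by
  constructor
  · rintro ⟨t, rfl⟩ s hs a
    rw [← weight_columnWeight]
    revert hs
    rw [mem_support_iff]
    revert s
    change IsWeightedHomogeneous (columnWeight a) (polyIso K M N _) (n a)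
    induction t using PiTensorProduct.induction_on with
    | add t u ht hu =>
      rw [map_add, map_add]
      exact ht.add hu
    | smul_tprod r f =>
      rw [map_smul, map_smul, PiTensorProduct.mapIncl, PiTensorProduct.map_tprod, polyIso_tprod,
        smul_eq_C_mul]
      refine IsWeightedHomogeneous.C_mul ?_ r
      have h1 := IsWeightedHomogeneous.prod Finset.univ
        (fun b => rename (fun i => (i, b)) (f b : MvPolynomial (Fin M) K))
        (fun b => if b = a then n b else 0) (w := columnWeight a)
        (fun b _ => rename_isWeightedHomogeneous a b
          ((mem_homogeneousSubmodule _ _).mp (f b).2))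
      simpa using h1
  · intro h
    -- A monomial in the `x i a` is the image of a pure tensor of monomials, one for each column,
    -- and the support condition fixes their degrees.
    have hw : w = ∑ s ∈ (polyIso K M N w).support, coeff s (polyIso K M N w) •
        PiTensorProduct.tprod K fun a => ∏ i, (X i : MvPolynomial (Fin M) K) ^ s (i, a) := by
      apply (polyIso K M N).injective
      rw [map_sum]
      conv_lhs => rw [← support_sum_monomial_coeff (polyIso K M N w)]
      refine Finset.sum_congr rfl fun s _ => ?_
      rw [map_smul, polyIso_tprod, monomial_eq, smul_eq_C_mul, Finsupp.prod_fintype _ _ (by simp),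
        Fintype.prod_prod_type_right]
      simp [map_prod]
    rw [hw]
    refine sum_mem fun s hs => Submodule.smul_mem _ _ ?_
    refine ⟨PiTensorProduct.tprod K fun a => ⟨∏ i, (X i : MvPolynomial (Fin M) K) ^ s (i, a), ?_⟩,
      ?_⟩
    · rw [mem_homogeneousSubmodule, ← h s hs a]
      exact IsHomogeneous.prod _ _ _ fun i _ => isHomogeneous_X_pow i _
    · rw [PiTensorProduct.mapIncl, PiTensorProduct.map_tprod]
      rfl

/-- The tensor degrees are the column sums of the exponent matrix and the weight is its row sums, a
description symmetric under transposition. Characteristic zero turns equality of weights in `K` into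
equality of integers. -/
theorem mem_weightSpace_iff [CharZero K] (n : Fin N → ℕ) (m : Fin M → ℕ) (w : PolyTensor K M N) :
    w ∈ weightSpace K M N n m ↔ ∀ s ∈ (polyIso K M N w).support,
      (∀ a, ∑ i, s (i, a) = n a) ∧ ∀ i, ∑ a, s (i, a) = m i := by
  have hdef : w ∈ weightSpace K M N n m ↔ w ∈ homTensor K M N n ∧ ∀ h : Fin M → K,
    tensorAction K M N (∑ a : Fin N, inFactor a (Matrix.diagonal h)) w
      = (∑ i, (m i : K) * h i) • w := Iff.rfl
  rw [hdef, mem_homTensor_iff]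
  constructor
  · rintro ⟨h1, h2⟩ s hs
    refine ⟨h1 s hs, fun i => ?_⟩
    have h3 := congrArg (fun v => coeff s (polyIso K M N v)) (h2 (Pi.single i 1))
    simp only [coeff_tensorAction_diagonal, map_smul, coeff_smul, smul_eq_mul] at h3
    have h4 := mul_right_cancel₀ (mem_support_iff.mp hs) h3
    simp only [Pi.single_apply, mul_ite, mul_one, mul_zero, Finset.sum_ite_eq',
      Finset.mem_univ, if_true] at h4
    exact_mod_cast h4
  · intro h
    refine ⟨fun s hs => (h s hs).1, fun g => ?_⟩
    apply (polyIso K M N).injective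
    ext s
    rw [coeff_tensorAction_diagonal, map_smul, coeff_smul, smul_eq_mul]
    by_cases hs : coeff s (polyIso K M N w) = 0
    · rw [hs, mul_zero, mul_zero]
    · simp only [(h s (mem_support_iff.mpr hs)).2]

theorem polyIso_dualityIso (w : PolyTensor K M N) :
    polyIso K N M (dualityIso K M N w) = rename Prod.swap (polyIso K M N w) :=
  (polyIso K N M).apply_symm_apply _

theorem dualityIso_mem_weightSpace [CharZero K] {n : Fin N → ℕ} {m : Fin M → ℕ}
    {w : PolyTensor K M N} (hw : w ∈ weightSpace K M N n m) :
    dualityIso K M N w ∈ weightSpace K N M m n := by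
  classical
  rw [mem_weightSpace_iff] at hw ⊢
  intro s hs
  rw [polyIso_dualityIso, support_rename_of_injective Prod.swap_injective, Finset.mem_image] at hs
  obtain ⟨t, ht, rfl⟩ := hs
  have hval : ∀ a i, Finsupp.mapDomain Prod.swap t (a, i) = t (i, a) := fun a i =>
    Finsupp.mapDomain_apply Prod.swap_injective t (i, a)
  simp only [hval]
  exact (hw t ht).symm

end Polynomials

section Eigenvalues

open DiffRing

/-! ### Eigenvectors and scalar operators -/

section Eigenvectors

variable {K : Type*} [Field K] {M N : ℕ} {z : Fin N → K} {lam : Fin M → K}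
  {w : PolyTensor K M N}

theorem prod_X_sub_C_ne_zero (z : Fin N → K) :
    (∏ a, (RatFunc.X - RatFunc.C (z a)) : RatFunc K) ≠ 0 :=
  Finset.prod_ne_zero_iff.mpr fun _ _ => X_sub_C_ne_zero _

theorem actOn_smul (f : RatFunc K) (g : RatFunc K ⊗[K] UGlTensor K M N) (w : PolyTensor K M N) :
    actOn K M N (f • g) w = f • actOn K M N g w :=
  (((tensorAction K M N).toLinearMap.flip w).baseChange (RatFunc K)).map_smul f g

theorem actOn_one (w : PolyTensor K M N) : actOn K M N 1 w = 1 ⊗ₜ w := by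
  have h : actOn K M N 1 w = 1 ⊗ₜ tensorAction K M N 1 w := rfl
  rw [h, map_one, Module.End.one_apply]

theorem actOn_zero (w : PolyTensor K M N) : actOn K M N 0 w = 0 := map_zero _

theorem actOn_polynomial (P : Polynomial (UGlTensor K M N)) (w : PolyTensor K M N) :
    actOn K M N (P.sum fun k p => (RatFunc.X ^ k : RatFunc K) ⊗ₜ[K] p) w
      = ∑ k ∈ Finset.range (P.natDegree + 1),
        (RatFunc.X ^ k : RatFunc K) ⊗ₜ[K] tensorAction K M N (P.coeff k) w := by
  rw [Polynomial.sum_over_range _ fun k => TensorProduct.tmul_zero _ _, actOn, map_sum]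
  rfl

theorem IsBetheEigenvector.exists_actOn_coeff (h : IsBetheEigenvector K M N z lam w) {k : ℕ}
    (hk : k ≤ M) : ∃ g : RatFunc K, actOn K M N ((gaudinOp K M N z lam).coeff k) w = g ⊗ₜ w := by
  rcases hk.eq_or_lt with rfl | hk
  -- The leading coefficient is not among the generators of the Bethe subalgebra; it acts as `1`.
  · exact ⟨1, by rw [gaudinOp_coeff_top, actOn_one]⟩
  have hki : M - (M - k) = k := by omega
  obtain ⟨P, hP⟩ := exists_polynomial_of_mem ((gaudinOp_poleBound z lam).2 k hk.le)
  rw [algebraMap_nodePoly, ← Finset.prod_pow] at hP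
  have hgen : ∀ l, ∃ c : K, tensorAction K M N (P.coeff l) w = c • w := fun l =>
    h.2 _ (Algebra.subset_adjoin ⟨M - k, by omega, by omega, P, by
      rw [transferMatrix, hki, hP], l, rfl⟩)
  choose c hc using hgen
  have h1 := congrArg (fun g => actOn K M N g w) hP
  simp only [actOn_smul, actOn_polynomial, hc, TensorProduct.tmul_smul, TensorProduct.smul_tmul',
    ← TensorProduct.sum_tmul] at h1
  have hne : (∏ a : Fin N, (RatFunc.X - RatFunc.C (z a)) ^ (M - k) : RatFunc K) ≠ 0 :=
    Finset.prod_ne_zero_iff.mpr fun _ _ => pow_ne_zero _ (X_sub_C_ne_zero _)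
  refine ⟨(∏ a : Fin N, (RatFunc.X - RatFunc.C (z a)) ^ (M - k) : RatFunc K)⁻¹ *
    ∑ l ∈ Finset.range (P.natDegree + 1), c l • RatFunc.X ^ l, ?_⟩
  rw [← smul_eq_mul, ← TensorProduct.smul_tmul', ← h1, smul_smul, inv_mul_cancel₀ hne, one_smul]

/-- If `G_i` acts on `w` by a rational scalar, comparing powers of `u` shows that each coefficient
of the cleared polynomial acts by a scalar in `K`. This property passes from generators to the whole
algebra. -/
theorem isBetheEigenvector_of_actOn_coeff (hw : w ≠ 0)
    (h : ∀ k ≤ M, ∃ g : RatFunc K,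
      actOn K M N ((gaudinOp K M N z lam).coeff k) w = g ⊗ₜ w) :
    IsBetheEigenvector K M N z lam w := by
  refine ⟨hw, fun g hg => ?_⟩
  induction hg using Algebra.adjoin_induction with
  | mem x hx =>
    obtain ⟨i, _, _, P, hP, l, rfl⟩ := hx
    obtain ⟨f, hf⟩ := h (M - i) (Nat.sub_le _ _)
    have h1 := congrArg (fun g => actOn K M N g w) hP
    simp only [actOn_smul, actOn_polynomial, transferMatrix, hf, TensorProduct.smul_tmul'] at h1
    rcases Nat.lt_or_ge l (P.natDegree + 1) with hl | hl
    · exact exists_smul_of_sum_pow_tmul h1.symm hl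
    · exact ⟨0, by rw [Polynomial.coeff_eq_zero_of_natDegree_lt hl, map_zero, zero_smul,
        LinearMap.zero_apply]⟩
  | algebraMap r => exact ⟨r, by rw [AlgHom.commutes, Module.algebraMap_end_apply]⟩
  | add x y _ _ hx hy =>
    obtain ⟨a, ha⟩ := hx
    obtain ⟨b, hb⟩ := hy
    exact ⟨a + b, by rw [map_add, LinearMap.add_apply, ha, hb, add_smul]⟩
  | mul x y _ _ hx hy =>
    obtain ⟨a, ha⟩ := hx
    obtain ⟨b, hb⟩ := hy
    exact ⟨b * a, by rw [map_mul, Module.End.mul_apply, hb, map_smul, ha, smul_smul]⟩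

theorem scalarOp_coeff (hw : w ≠ 0) {g : ℕ → RatFunc K}
    (h : ∀ k ≤ M, actOn K M N ((gaudinOp K M N z lam).coeff k) w = g k ⊗ₜ w) (k : ℕ) :
    (scalarOp K M N z lam w).coeff k = if k ≤ M then g k else 0 := by
  have hev : ∀ i, transferEigenvalue K M N z lam w i = g (M - i) := by
    intro i
    have hex : ∃ f : RatFunc K, actOn K M N (transferMatrix K M N z lam i) w = f ⊗ₜ[K] w :=
      ⟨g (M - i), h _ (Nat.sub_le _ _)⟩
    rw [transferEigenvalue, dif_pos hex]
    -- The eigenvalue selected by choice is the given one, since `w ≠ 0` makes it unique.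
    exact tmul_right_injective hw (hex.choose_spec.symm.trans (h _ (Nat.sub_le _ _)))
  have htop : g M = 1 := by
    refine tmul_right_injective hw ((h M le_rfl).symm.trans ?_)
    rw [gaudinOp_coeff_top, actOn_one]
  have hdel : (del (scalarDeriv K) ^ M).coeff k = if M = k then 1 else 0 := by
    rw [← coeff_of_mul_del_pow (scalarDeriv K) 1 M k, map_one, one_mul]
  rw [scalarOp, coeff_add, coeff_sum, hdel]
  simp only [coeff_of_mul_del_pow, hev]
  rcases lt_trichotomy k M with hk | rfl | hk
  · rw [if_neg hk.ne', if_pos hk.le, zero_add, Finset.sum_eq_single (M - k)]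
    · rw [Nat.sub_sub_self hk.le, if_pos rfl]
    · intro i hi hik
      rw [Finset.mem_Icc] at hi
      rw [if_neg (by omega)]
    · intro hmem
      exact absurd (Finset.mem_Icc.mpr ⟨by omega, by omega⟩) hmem
  · rw [if_pos rfl, if_pos le_rfl, htop, Finset.sum_eq_zero, add_zero]
    intro i hi
    rw [Finset.mem_Icc] at hi
    rw [if_neg (by omega)]
  · rw [if_neg hk.ne, if_neg (by omega), zero_add]
    refine Finset.sum_eq_zero fun i _ => ?_
    rw [if_neg (by omega)]

theorem actOn_coeff_eq_scalarOp (hw : w ≠ 0) {g : ℕ → RatFunc K}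
    (h : ∀ k ≤ M, actOn K M N ((gaudinOp K M N z lam).coeff k) w = g k ⊗ₜ w) (k : ℕ) :
    actOn K M N ((gaudinOp K M N z lam).coeff k) w
      = (scalarOp K M N z lam w).coeff k ⊗ₜ[K] w := by
  rw [scalarOp_coeff hw h]
  split_ifs with hk
  · exact h k hk
  · rw [(gaudinOp_poleBound z lam).1 k (by omega), actOn_zero, TensorProduct.zero_tmul]

theorem of_mul_scalarOp (hw : w ≠ 0) {g : ℕ → RatFunc K}
    (h : ∀ k ≤ M, actOn K M N ((gaudinOp K M N z lam).coeff k) w = g k ⊗ₜ w) (f : RatFunc K)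
    (A : Fin (N + 1) → Fin (M + 1) → K)
    (hA : ∀ b : Fin (M + 1), f * g b = ∑ a, RatFunc.C (A a b) * RatFunc.X ^ (a : ℕ)) :
    of (scalarDeriv K) f * scalarOp K M N z lam w
      = ∑ b, ∑ a, of (scalarDeriv K) (RatFunc.C (A a b) * RatFunc.X ^ (a : ℕ))
          * del (scalarDeriv K) ^ (b : ℕ) := by
  refine ext_coeff _ fun k => ?_
  rw [coeff_of_mul, scalarOp_coeff hw h]
  simp only [coeff_sum, coeff_of_mul_del_pow]
  split_ifs with hk
  · rw [Finset.sum_eq_single ⟨k, Nat.lt_succ_of_le hk⟩]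
    · simpa using hA ⟨k, Nat.lt_succ_of_le hk⟩
    · intro b _ hb
      have hne : (b : ℕ) ≠ k := fun h => hb (Fin.ext h)
      simp [hne]
    · simp
  · rw [mul_zero, eq_comm]
    refine Finset.sum_eq_zero fun b _ => Finset.sum_eq_zero fun a _ => ?_
    rw [if_neg (by omega)]

end Eigenvectors

/-! ### Transport to polynomials -/

section Transport

variable {K : Type*} [Field K] {M N : ℕ} {V : Type*} [CommRing V] [Algebra K V]

/-- The action of `U(gl_M)^{⊗ N}` transported along a linear isomorphism. -/
def transportedAction (e : PolyTensor K M N ≃ₗ[K] V) : UGlTensor K M N →ₐ[K] Module.End K V :=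
  (e.conjAlgEquiv K).toAlgHom.comp (tensorAction K M N)

theorem transportedAction_apply (e : PolyTensor K M N ≃ₗ[K] V) (g : UGlTensor K M N)
    (v : PolyTensor K M N) : transportedAction e g (e v) = e (tensorAction K M N g v) := by
  change e (tensorAction K M N g (e.symm (e v))) = _
  rw [e.symm_apply_apply]

theorem lTensor_actOn (e : PolyTensor K M N ≃ₗ[K] V) (g : RatFunc K ⊗[K] UGlTensor K M N)
    (w : PolyTensor K M N) :
    e.toLinearMap.lTensor (RatFunc K) (actOn K M N g w)
      = actCoeff (transportedAction e) (e w) g := by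
  induction g using TensorProduct.induction_on with
  | zero => rw [actOn_zero, map_zero, map_zero]
  | add x y hx hy =>
    rw [map_add, ← hx, ← hy, ← map_add]
    exact congrArg _ (map_add _ x y)
  | tmul f a =>
    rw [actCoeff_tmul, transportedAction_apply]
    rfl

/-- Eigenvalue equations may be checked after transport, so both models can be compared on the same
space `K[x_ij]`. -/
theorem actOn_eq_tmul_iff (e : PolyTensor K M N ≃ₗ[K] V) (g : RatFunc K ⊗[K] UGlTensor K M N)
    (w : PolyTensor K M N) (f : RatFunc K) :
    actOn K M N g w = f ⊗ₜ w ↔ actCoeff (transportedAction e) (e w) g = f ⊗ₜ e w := by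
  rw [← lTensor_actOn]
  refine ⟨fun h => by rw [h]; rfl, fun h => ?_⟩
  exact (LinearEquiv.lTensor (RatFunc K) e).injective h

/-- The identification of `K[x_1, …, x_N]^{⊗ M}` with `K[x_ij]`. -/
def dualPolyIso (K : Type*) [Field K] (M N : ℕ) :
    PolyTensor K N M ≃ₐ[K] MvPolynomial (Fin M × Fin N) K :=
  (polyIso K N M).trans (MvPolynomial.renameEquiv K (Equiv.prodComm (Fin N) (Fin M)))

theorem dualPolyIso_dualityIso (w : PolyTensor K M N) :
    dualPolyIso K M N (dualityIso K M N w) = polyIso K M N w := by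
  change MvPolynomial.rename _ (polyIso K N M (dualityIso K M N w)) = _
  rw [polyIso_dualityIso, MvPolynomial.rename_rename]
  exact MvPolynomial.rename_id_apply _

theorem transportedAction_polyIso (a : Fin N) (i j : Fin M)
    (v : MvPolynomial (Fin M × Fin N) K) :
    transportedAction (polyIso K M N).toLinearEquiv (inFactor a (Matrix.single i j 1)) v
      = (polyPolarization K M N).x i a * (polyPolarization K M N).D j a v := by
  obtain ⟨w, rfl⟩ := (polyIso K M N).surjective v
  exact (transportedAction_apply _ _ w).trans (polyIso_tensorAction_single a i j w)

theorem transportedAction_dualPolyIso (i : Fin M) (a b : Fin N)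
    (v : MvPolynomial (Fin M × Fin N) K) :
    transportedAction (dualPolyIso K M N).toLinearEquiv (inFactor i (Matrix.single a b 1)) v
      = (polyPolarization K M N).transpose.x a i *
        (polyPolarization K M N).transpose.D b i v := by
  obtain ⟨w, rfl⟩ := (dualPolyIso K M N).surjective v
  refine (transportedAction_apply _ _ w).trans ?_
  change MvPolynomial.rename _ (polyIso K N M _) = MvPolynomial.X (i, a) *
    MvPolynomial.pderiv (i, b) (MvPolynomial.rename _ (polyIso K N M w))
  rw [polyIso_tensorAction_single, map_mul, MvPolynomial.rename_X]
  congr 1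
  exact (MvPolynomial.pderiv_rename
    (Equiv.prodComm (Fin N) (Fin M)).injective (b, i) _).symm

end Transport

end Eigenvalues

end BetheDuality

end

/-! ### Proof of the duality theorem. -/

open BetheDuality in
theorem corollary3p2 {K : Type*} [Field K] [CharZero K] (M N : ℕ)
    (z : Fin N → K) (lam : Fin M → K)
    (hz : Function.Injective z) (hlam : Function.Injective lam)
    (n : Fin N → ℕ) (m : Fin M → ℕ) (hnm : ∑ a, n a = ∑ b, m b)
    (w : PolyTensor K M N) (hw : w ∈ weightSpace K M N n m)
    (heig : IsBetheEigenvector K M N z lam w) :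
    -- `w` corresponds to an eigenvector in the dual weight space
    dualityIso K M N w ∈ weightSpace K N M m n ∧
    IsBetheEigenvector K N M lam z (dualityIso K M N w) ∧
    -- the two row determinants act on it by the scalar differential operators
    (∀ k, actOn K M N ((gaudinOp K M N z lam).coeff k) w
      = (scalarOp K M N z lam w).coeff k ⊗ₜ[K] w) ∧
    (∀ k, actOn K N M ((gaudinOp K N M lam z).coeff k) (dualityIso K M N w)
      = (scalarOp K N M lam z (dualityIso K M N w)).coeff k ⊗ₜ[K] dualityIso K M N w) ∧
    ∃ A : Fin (N + 1) → Fin (M + 1) → K,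
      DiffRing.of (scalarDeriv K) (∏ a : Fin N, (RatFunc.X - RatFunc.C (z a))) * scalarOp K M N z lam w
        = ∑ a, ∑ b, DiffRing.of (scalarDeriv K) (RatFunc.C (A a b) * RatFunc.X ^ (a : ℕ))
            * DiffRing.del (scalarDeriv K) ^ (b : ℕ) ∧
      DiffRing.of (scalarDeriv K) (∏ b : Fin M, (RatFunc.X - RatFunc.C (lam b)))
          * scalarOp K N M lam z (dualityIso K M N w)
        = ∑ a, ∑ b, DiffRing.of (scalarDeriv K) (RatFunc.C (A a b) * RatFunc.X ^ (b : ℕ))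
            * DiffRing.del (scalarDeriv K) ^ (a : ℕ) := by
  have : Infinite K := Infinite.of_injective ((↑) : ℕ → K) Nat.cast_injective
  have hw0 : w ≠ 0 := heig.1
  have hw0' : dualityIso K M N w ≠ 0 := (map_ne_zero_iff _ (dualityIso K M N).injective).mpr hw0
  have hW0 : polyIso K M N w ≠ 0 := (map_ne_zero_iff _ (polyIso K M N).injective).mpr hw0
  let P := polyPolarization K M N
  -- `t a b` is the result on `w` of the operator with symbol the coefficient of `u ^ a * p ^ b`,
  -- the operator shared by the two models.
  let t : ℕ → ℕ → MvPolynomial (Fin M × Fin N) K := fun a b =>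
    P.normalOrder (polyIso K M N w) (((capelliPoly P.symX P.symY z lam).coeff b).coeff a)
  have hg : ∀ k, ∃ g : RatFunc K, k ≤ M →
      actOn K M N ((gaudinOp K M N z lam).coeff k) w = g ⊗ₜ w := fun k => by
    by_cases hk : k ≤ M
    · exact (heig.exists_actOn_coeff hk).imp fun g hg _ => hg
    -- The value beyond order `M` is arbitrary; it only makes `g` a total function.
    · exact ⟨0, fun h => absurd h hk⟩
  choose g hg using hg
  have hsum : ∀ b ≤ M, ∑ a ∈ Finset.range (N + 1), (RatFunc.X ^ a : RatFunc K) ⊗ₜ[K] t a b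
      = ((∏ a, (RatFunc.X - RatFunc.C (z a)) : RatFunc K) * g b) ⊗ₜ polyIso K M N w := by
    intro b hb
    rw [← P.actCoeff_gaudinOp _ z lam _ transportedAction_polyIso hb, ← smul_eq_mul,
      ← TensorProduct.smul_tmul']
    congr 1
    exact (actOn_eq_tmul_iff (polyIso K M N).toLinearEquiv _ _ _).mp (hg b hb)
  -- The numbers `A a b` arise here: comparing powers of `u` forces each `t a b` onto the line of
  -- `w`.
  have hA : ∀ (a : Fin (N + 1)) (b : Fin (M + 1)), ∃ c : K, t a b = c • polyIso K M N w :=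
    fun a b => exists_smul_of_sum_pow_tmul (hsum b (Nat.le_of_lt_succ b.2)) a.2
  choose A hA using hA
  have hgA : ∀ b : Fin (M + 1), (∏ a, (RatFunc.X - RatFunc.C (z a)) : RatFunc K) * g b
      = ∑ a, RatFunc.C (A a b) * RatFunc.X ^ (a : ℕ) := by
    intro b
    refine tmul_right_injective hW0 ((hsum b (Nat.le_of_lt_succ b.2)).symm.trans ?_)
    rw [← Fin.sum_univ_eq_sum_range
      (fun a => (RatFunc.X ^ a : RatFunc K) ⊗ₜ[K] t a b), TensorProduct.sum_tmul]
    refine Finset.sum_congr rfl fun a _ => ?_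
    rw [hA, TensorProduct.tmul_smul, TensorProduct.smul_tmul', RatFunc.smul_eq_C_mul]
  -- The dual eigenvalues are defined from the same numbers, with `b` now the exponent of the
  -- variable; that they are eigenvalues is proved below.
  let g' : ℕ → RatFunc K := fun a => if ha : a < N + 1 then
    (∏ b, (RatFunc.X - RatFunc.C (lam b)) : RatFunc K)⁻¹ *
      ∑ b, RatFunc.C (A ⟨a, ha⟩ b) * RatFunc.X ^ (b : ℕ) else 0
  have hgA' : ∀ a : Fin (N + 1), (∏ b, (RatFunc.X - RatFunc.C (lam b)) : RatFunc K) * g' a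
      = ∑ b, RatFunc.C (A a b) * RatFunc.X ^ (b : ℕ) := by
    intro a
    simp only [g', a.2, dif_pos]
    exact mul_inv_cancel_left₀ (prod_X_sub_C_ne_zero lam) _
  have hg' : ∀ a ≤ N, actOn K N M ((gaudinOp K N M lam z).coeff a) (dualityIso K M N w)
      = g' a ⊗ₜ dualityIso K M N w := by
    intro a ha
    have hdual : (dualPolyIso K M N).toLinearEquiv (dualityIso K M N w) = polyIso K M N w :=
      dualPolyIso_dualityIso w
    rw [actOn_eq_tmul_iff (dualPolyIso K M N).toLinearEquiv, hdual]
    have hact := P.transpose.actCoeff_gaudinOp _ lam z (polyIso K M N w)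
      transportedAction_dualPolyIso ha
    have hne := prod_X_sub_C_ne_zero lam
    -- The equation is checked after multiplication by the nonzero product `∏ b, (v - lam b)`, where
    -- the Capelli expansion of the transposed model applies.
    refine (smul_right_injective _ hne) (hact.trans ?_)
    change _ = (∏ b, (RatFunc.X - RatFunc.C (lam b)) : RatFunc K) • g' a ⊗ₜ[K] polyIso K M N w
    have haN : a < N + 1 := Nat.lt_succ_of_le ha
    rw [TensorProduct.smul_tmul', smul_eq_mul, hgA' ⟨a, haN⟩, TensorProduct.sum_tmul,
      ← Fin.sum_univ_eq_sum_range (fun b => (RatFunc.X ^ b : RatFunc K) ⊗ₜ[K]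
        P.transpose.normalOrder (polyIso K M N w)
          (((capelliPoly P.transpose.symX P.transpose.symY lam z).coeff a).coeff b))]
    refine Finset.sum_congr rfl fun b _ => ?_
    -- Transposition leaves the quantization unchanged and identifies the Capelli coefficients, so
    -- both models use the same vector `t a b`.
    have ht : P.transpose.normalOrder (polyIso K M N w)
        (((capelliPoly P.transpose.symX P.transpose.symY lam z).coeff a).coeff b) = t a b :=
      congrArg (P.normalOrder (polyIso K M N w))
        (coeff_capelliPoly_transpose P.symX P.symY z lam a b)
    rw [ht, hA ⟨a, haN⟩ b, TensorProduct.tmul_smul, TensorProduct.smul_tmul',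
      RatFunc.smul_eq_C_mul]
  refine ⟨dualityIso_mem_weightSpace hw,
    isBetheEigenvector_of_actOn_coeff hw0' fun k hk => ⟨g' k, hg' k hk⟩,
    actOn_coeff_eq_scalarOp hw0 hg, actOn_coeff_eq_scalarOp hw0' hg', A, ?_, ?_⟩
  · rw [Finset.sum_comm]
    exact of_mul_scalarOp hw0 hg _ A hgA
  · exact of_mul_scalarOp hw0' hg' _ (fun b a => A a b) hgA'
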